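/- Let $\tau$ be a finite signature (possibly with relation, function and constant symbols) and let $\mathfrak A$ be a $\tau$-structure with non-empty domain $A$ such that - $\mathfrak A$ is model-complete, i.e., every first-order $\tau$-formula is equivalent over $\mathfrak A$ to an existential $\tau$-formula; - $\mathfrak A$ is $\omega$-categorical, i.e., all countably infinite models of the first-order theory of $\mathfrak A$ are isomorphic; - there is an embedding $\mathfrak A^2 \hookrightarrow \mathfrak A$, where $\mathfrak A^2=\mathfrak A\times\mathfrak A$ is the direct product (an embedding is an isomorphism onto a substructure). For a structure $\mathfrak B$ with finite signature $\sigma$, let $\mathrm{CSP}(\mathfrak B)$ be the problem of deciding whether a given finite conjunction of atomic $\sigma$-formulas (equations $s=t$ between $\sigma$-terms and formulas $R(t_1,\dots,t_k)$, where $R\in\sigma$ is a relation symbol) is satisfiable in $\mathfrak B$. Let $(\mathfrak A,\neq)$ be the expansion of $\mathfrak A$ by the binary disequality relation on $A$ and, for $a_1,\dots,a_n\in A$, let $(\mathfrak A,a_1,\dots,a_n)$ be the expansion of $\mathfrak A$ by constant symbols denoting $a_1,\dots,a_n$. Then there are $n\ge 0$ and $a_1,\dots,a_n\in A$ such that $\mathrm{CSP}(\mathfrak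 A,\neq)$ and $\mathrm{CSP}(\mathfrak A,a_1,\dots,a_n)$ are polynomial-time equivalent, i.e., each of the two problems has a polynomial-time Turing reduction to the other one (it can be decided in polynomial time by a machine with an oracle for the other problem). -/

import Mathlib

namespace CspEq

universe u v w

/-! ### Decision problems and polynomial-time Turing reductions -/

/-- A decision problem: a type of instances, written down as words over an alphabet (different
instances being written differently), together with the set of yes-instances. -/
structure DecisionProblem : Type (u + 1) where
  Instance : Type u
  Letter : Type u
  encode : Instance → List Letter
  encode_injective : Function.Injective encode
  Yes : Instance → Prop

/-- The set of words that encode yes-instances. -/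
def DecisionProblem.language (X : DecisionProblem.{u}) : Set (List X.Letter) :=
  {w | ∃ x, X.Yes x ∧ X.encode x = w}

/-- Oracle machines with input alphabet `Γin` and oracle alphabet `Γq`: multi-stack Turing machines
(in Mathlib's model `Turing.TM2`) with finitely many stacks, labels, internal states and
stack symbols, which have a designated input stack and a designated query stack. A label `l` with
`ask l = some (yes, no)` is a query label: when it is reached, the oracle is asked about the word on
the query stack, the query stack is erased, and the computation continues at `yes` or at `no`
according to the answer. All other labels execute the statement `prog l`. The machine accepts if it
halts in an internal state `v` with `accept v = true`. -/
structure OracleTM (Γin Γq : Type*) where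
  /-- the stacks -/
  K : Type
  [decEqK : DecidableEq K]
  [finK : Finite K]
  /-- the stack symbols -/
  Γ : Type
  [finΓ : Finite Γ]
  /-- the labels -/
  Λ : Type
  [finΛ : Finite Λ]
  /-- the internal states -/
  σ : Type
  [finσ : Finite σ]
  /-- the symbols used for the input letters -/
  inLetter : Γin ↪ Γ
  /-- the symbols used for the letters of the oracle alphabet -/
  qLetter : Γq ↪ Γ
  inputStack : K
  queryStack : K
  main : Λ
  initialState : σ
  prog : Λ → Turing.TM2.Stmt (fun _ : K => Γ) Λ σ
  ask : Λ → Option (Λ × Λ)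
  accept : σ → Bool

attribute [instance] OracleTM.decEqK OracleTM.finK OracleTM.finΓ OracleTM.finΛ OracleTM.finσ

namespace OracleTM

variable {Γin Γq : Type*} (M : OracleTM Γin Γq)

/-- Configurations: the current label (`none` if the machine has halted), the internal state, and
the contents of the stacks. -/
abbrev Cfg : Type := Turing.TM2.Cfg (fun _ : M.K => M.Γ) M.Λ M.σ

/-- The initial configuration: the input word is on the input stack (its first letter on top), and
all other stacks are empty. -/
def init (w : List Γin) : M.Cfg where
  l := some M.main
  var := M.initialState
  stk := Function.update (fun _ => []) M.inputStack (w.map M.inLetter)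

open Classical in
/-- One step of the machine with oracle set `Y`; the word on the query stack is read from the top
of the stack. -/
noncomputable def step (Y : Set (List Γq)) : M.Cfg → Option M.Cfg
  | ⟨none, _, _⟩ => none
  | ⟨some l, v, S⟩ =>
    match M.ask l with
    | none => some (Turing.TM2.stepAux (M.prog l) v S)
    | some (yes, no) =>
      some ⟨some (if ∃ w ∈ Y, S M.queryStack = w.map M.qLetter then yes else no), v,
        Function.update S M.queryStack []⟩

end OracleTM

/-- `X` has a polynomial-time Turing reduction to `Y`: some oracle machine with oracle `Y` decides
`X` in a number of steps that is bounded by a polynomial in the length of the input. -/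
def PolyTimeReducible (X Y : DecisionProblem.{u}) : Prop :=
  ∃ (M : OracleTM X.Letter Y.Letter) (p : Polynomial ℕ), ∀ x : X.Instance, ∃ c : M.Cfg,
    Nonempty (StateTransition.EvalsToInTime (M.step Y.language) (M.init (X.encode x)) (some c)
      (p.eval (X.encode x).length)) ∧
    c.l = none ∧ (M.accept c.var = true ↔ X.Yes x)

/-- Polynomial-time equivalence of decision problems. -/
def PolyTimeEquivalent (X Y : DecisionProblem.{u}) : Prop :=
  PolyTimeReducible X Y ∧ PolyTimeReducible Y X

/-! ### Constraint satisfaction problems -/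

/-- Atomic formulas over `L` with variables from `V`. -/
inductive Atom (L : FirstOrder.Language.{u, v}) (V : Type w) : Type (max u v w)
  | eq (s t : L.Term V) : Atom L V
  | rel {n : ℕ} (R : L.Relations n) (ts : Fin n → L.Term V) : Atom L V

/-- Truth of an atomic formula in a structure under an assignment to the variables. -/
def Atom.Holds {L : FirstOrder.Language.{u, v}} {V : Type*} {A : Type*} [L.Structure A] (x : V → A) :
    Atom L V → Prop
  | .eq s t => s.realize x = t.realize x
  | .rel R ts => FirstOrder.Language.Structure.RelMap R fun i => (ts i).realize x

/-- Variables are named by finite binary words. -/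
abbrev Var : Type := List Bool

/-- The alphabet in which instances of constraint satisfaction problems are written. -/
inductive Letter (L : FirstOrder.Language.{u, v}) : Type (max u v)
  | fn {n : ℕ} (f : L.Functions n) : Letter L
  | rel {n : ℕ} (R : L.Relations n) : Letter L
  | eq : Letter L
  | var : Letter L
  | bit (b : Bool) : Letter L
  | endVar : Letter L
  | comma : Letter L
  | semicolon : Letter L

section Encoding

variable {L : FirstOrder.Language.{u, v}}

/-- Terms are written in Polish notation; a variable is written as its name, between delimiters. -/
def encodeTerm : L.Term Var → List (Letter L)
  | .var x => .var :: (x.map .bit ++ [.endVar])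
  | .func (l := n) f ts => .fn f :: (List.finRange n).flatMap fun i => encodeTerm (ts i)

/-- An atomic formula is written as its relation symbol or the equality symbol, then its arguments
each followed by a comma, then a semicolon. -/
def encodeAtom : Atom L Var → List (Letter L)
  | .eq s t => .eq :: (encodeTerm s ++ .comma :: (encodeTerm t ++ [.comma, .semicolon]))
  | .rel (n := n) R ts =>
    .rel R :: ((List.finRange n).flatMap (fun i => encodeTerm (ts i) ++ [.comma]) ++ [.semicolon])

/-- A conjunction of atomic formulas is written as the list of its conjuncts. -/
def encodeInstance (Φ : List (Atom L Var)) : List (Letter L) :=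
  Φ.flatMap encodeAtom

lemma flatMap_cancel {ι α β : Type*} (e : α → List β) (f g : ι → α) (is : List ι)
    (h : ∀ i ∈ is, ∀ a l l', e (f i) ++ l = e a ++ l' → f i = a ∧ l = l') (l l' : List β)
    (hl : is.flatMap (fun i => e (f i)) ++ l = is.flatMap (fun i => e (g i)) ++ l') :
    (∀ i ∈ is, f i = g i) ∧ l = l' := by
  induction is with
  | nil => simpa using hl
  | cons i is ih =>
    simp only [List.flatMap_cons, List.append_assoc] at hl
    obtain ⟨h1, h2⟩ := h i (by simp) _ _ _ hl
    obtain ⟨h3, h4⟩ := ih (fun j hj => h j (by simp [hj])) h2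
    exact ⟨by simpa [h1] using h3, h4⟩

lemma bits_cancel (x y : List Bool) (l l' : List (Letter L))
    (h : x.map Letter.bit ++ .endVar :: l = y.map Letter.bit ++ .endVar :: l') :
    x = y ∧ l = l' := by
  induction x generalizing y with
  | nil => cases y <;> simp_all
  | cons a x ih =>
    cases y with
    | nil => simp at h
    | cons b y =>
      simp only [List.map_cons, List.cons_append, List.cons.injEq, Letter.bit.injEq] at h
      obtain ⟨h1, h2⟩ := ih y h.2
      exact ⟨by rw [h.1, h1], h2⟩

lemma encodeTerm_cancel (s t : L.Term Var) (l l' : List (Letter L))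
    (h : encodeTerm s ++ l = encodeTerm t ++ l') : s = t ∧ l = l' := by
  induction s generalizing t l l' with
  | var x =>
    cases t with
    | var y =>
      simp only [encodeTerm, List.cons_append, List.append_assoc, List.cons.injEq, true_and,
        List.nil_append] at h
      obtain ⟨h1, h2⟩ := bits_cancel _ _ _ _ h
      exact ⟨by rw [h1], h2⟩
    | func f ts => simp [encodeTerm] at h
  | @func n f ts ih =>
    cases t with
    | var y => simp [encodeTerm] at h
    | @func m g us =>
      simp only [encodeTerm, List.cons_append, List.cons.injEq, Letter.fn.injEq] at h
      obtain ⟨⟨rfl, hfg⟩, h⟩ := h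
      obtain rfl := eq_of_heq hfg
      obtain ⟨h1, h2⟩ := flatMap_cancel encodeTerm ts us _ (fun i _ => ih i) l l' h
      exact ⟨by rw [show ts = us from funext fun i => h1 i (by simp)], h2⟩

lemma encodeAtom_cancel (a b : Atom L Var) (l l' : List (Letter L))
    (h : encodeAtom a ++ l = encodeAtom b ++ l') : a = b ∧ l = l' := by
  cases a with
  | eq s t =>
    cases b with
    | eq s' t' =>
      simp only [encodeAtom, List.cons_append, List.append_assoc, List.cons.injEq, true_and] at h
      obtain ⟨h1, h⟩ := encodeTerm_cancel _ _ _ _ h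
      obtain ⟨h2, h⟩ := encodeTerm_cancel _ _ _ _ (List.cons.inj h).2
      exact ⟨by rw [h1, h2], by simpa using h⟩
    | rel R ts => simp [encodeAtom] at h
  | @rel n R ts =>
    cases b with
    | eq s t => simp [encodeAtom] at h
    | @rel m R' us =>
      simp only [encodeAtom, List.cons_append, List.cons.injEq, Letter.rel.injEq,
        List.append_assoc] at h
      obtain ⟨⟨rfl, hR⟩, h⟩ := h
      obtain rfl := eq_of_heq hR
      obtain ⟨h1, h2⟩ := flatMap_cancel (fun t => encodeTerm t ++ [.comma]) ts us _
        (fun i _ a k k' hk => by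
          simp only [List.append_assoc, List.cons_append, List.nil_append] at hk
          obtain ⟨h3, h4⟩ := encodeTerm_cancel _ _ _ _ hk
          exact ⟨h3, by simpa using h4⟩) _ _ h
      refine ⟨by rw [show ts = us from funext fun i => h1 i (by simp)], by simpa using h2⟩

lemma encodeInstance_injective :
    Function.Injective (encodeInstance : List (Atom L Var) → List (Letter L)) := by
  have hne : ∀ a : Atom L Var, encodeAtom a ≠ [] := by
    intro a; cases a <;> simp [encodeAtom]
  intro Φ
  induction Φ with
  | nil =>
    intro Ψ h
    cases Ψ with
    | nil => rfl
    | cons b Ψ => simp [encodeInstance, hne] at h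
  | cons a Φ ih =>
    intro Ψ h
    cases Ψ with
    | nil => simp [encodeInstance, hne] at h
    | cons b Ψ =>
      simp only [encodeInstance, List.flatMap_cons] at h
      obtain ⟨h1, h2⟩ := encodeAtom_cancel _ _ _ _ h
      rw [h1, ih h2]

end Encoding

/-- The constraint satisfaction problem of an `L`-structure `A`: given a finite conjunction of atomic
`L`-formulas, is it satisfiable in `A`? -/
def csp (L : FirstOrder.Language.{u, v}) (A : Type w) [L.Structure A] : DecisionProblem.{max u v} where
  Instance := List (Atom L Var)
  Letter := Letter L
  encode := encodeInstance
  encode_injective := encodeInstance_injective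
  Yes Φ := ∃ x : Var → A, ∀ φ ∈ Φ, φ.Holds x

/-- The only relation symbol of the signature `{≠}`. -/
inductive NeqRel : ℕ → Type
  | neq : NeqRel 2

/-- The signature consisting of a single binary relation symbol `≠`. -/
def neqLanguage : FirstOrder.Language.{0, 0} := ⟨fun _ => Empty, NeqRel⟩

/-- The symbol `≠` is interpreted as the disequality relation. -/
instance neqStructure (A : Type w) : neqLanguage.Structure A where
  funMap f := Empty.elim f
  RelMap | .neq => fun x => x 0 ≠ x 1

/-- The problem `CSP(A, ≠)`. -/
def cspNeq (L : FirstOrder.Language.{u, v}) (A : Type w) [L.Structure A] : DecisionProblem.{max u v} :=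
  csp (L.sum neqLanguage) A

/-- The problem `CSP(A, a₁, …, aₙ)`, where `(A, a₁, …, aₙ)` is the expansion of `A` by `n` constant
symbols denoting `a₁, …, aₙ`. -/
def cspConstants (L : FirstOrder.Language.{u, v}) (A : Type w) [L.Structure A] {n : ℕ} (a : Fin n → A) :
    DecisionProblem.{max u v} :=
  letI : (FirstOrder.Language.constantsOn (Fin n)).Structure A := FirstOrder.Language.constantsOn.structure a
  csp (L.sum (FirstOrder.Language.constantsOn (Fin n))) A

/-! ### Model theory -/

/-- `A` is model-complete: every first-order formula is equivalent over `A` to an existential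
formula. -/
def ModelComplete (L : FirstOrder.Language.{u, v}) (A : Type w) [L.Structure A] : Prop :=
  ∀ (n : ℕ) (φ : L.Formula (Fin n)), ∃ ψ : L.Formula (Fin n),
    FirstOrder.Language.BoundedFormula.IsExistential ψ ∧ ∀ x : Fin n → A, φ.Realize x ↔ ψ.Realize x

/-- `A` is `ω`-categorical: all countably infinite models of its theory are isomorphic. -/
def OmegaCategorical (L : FirstOrder.Language.{u, v}) (A : Type w) [L.Structure A] : Prop :=
  Cardinal.Categorical Cardinal.aleph0.{w} (L.completeTheory A)

/-- The product structure on `A × B`. -/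
instance prodStructure (L : FirstOrder.Language.{u, v}) (A B : Type*) [L.Structure A] [L.Structure B] :
    L.Structure (A × B) where
  funMap f x := (FirstOrder.Language.Structure.funMap f fun i => (x i).1,
    FirstOrder.Language.Structure.funMap f fun i => (x i).2)
  RelMap R x := (FirstOrder.Language.Structure.RelMap R fun i => (x i).1) ∧
    FirstOrder.Language.Structure.RelMap R fun i => (x i).2

end CspEq

/-! By the theorem of Ryll-Nardzewski (`OmegaCategorical.exists_finite_types`), finitely many tuples
represent all first-order types of tuples of a given length. List representatives of the pairs of
distinct elements in one long tuple `t`. The existentially quantified conjunctions over the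
signature with `≠` that hold at a tuple (`Sat`) form one of finitely many sets, so above the set of
`t` there is a maximal one, attained at a tuple `a`. By finiteness again, one conjunction `Ψ₀`
isolates it: each tuple satisfying `Ψ₀` satisfies exactly the same conjunctions as `a`
(`exists_maximal_tuple`, `exists_constants`). The entries of `a` are the required constants.

From constants to `≠`: turn the constants into variables and add `Ψ₀` on these variables. A solution
assigns to them a tuple satisfying `Ψ₀`, and whatever is satisfiable there is satisfiable at `a`.

From `≠` to constants: for each disequality `s ≠ t`, ask whether the positive atoms together with `s
= a (i m)` and `t = a (j m)` are satisfiable for some `m`. If the instance has a solution, the pair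
of values of `s` and `t` has the type of a listed pair; what holds there also holds at the
corresponding entries of `a`. Conversely, these entries of `a` are distinct, because `≠` is itself
an atom. So each disequality is satisfiable together with the positive atoms, and the embedding of
the square combines these solutions into one (`exists_holds_of_forall_neqAtom`).

Both reductions have the same shape: at every position of the input, some query from a fixed finite
list must succeed, and each query is the output of a finite state transducer on the input with this
position marked. `polyTimeReducible_of_transducer` provides one machine for all reductions of this
kind, so that only words have to be computed afterwards. -/

namespace CspEq

open FirstOrder FirstOrder.Language Cardinal

universe u v w

/-! ### Quantification over infinite sets of variables, and compactness -/

section Formulas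

variable {L : FirstOrder.Language.{u, v}} {α β : Type*}

/-- Formulas depend on finitely many of their variables only. -/
lemma exists_finset_realize_congr (φ : L.Formula α) (M : Type*) [L.Structure M] :
    ∃ s : Finset α, ∀ x y : α → M, (∀ i ∈ s, x i = y i) → (φ.Realize x ↔ φ.Realize y) := by
  classical
  refine ⟨φ.freeVarFinset, fun x y h => ?_⟩
  have key := fun z : α → M => BoundedFormula.realize_restrictFreeVar (φ := φ) (f := id)
    (v := fun a => z a) (xs := default) z (fun _ => rfl)
  have hxy : (fun a : φ.freeVarFinset => x a) = fun a : φ.freeVarFinset => y a :=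
    funext fun a => h a a.2
  exact (key x).symm.trans (by rw [hxy]; exact key y)

/-- Existential quantification over arbitrarily many variables is expressible. -/
lemma exists_formula_realize_iff_exists (φ : L.Formula (α ⊕ β)) (M : Type*) [L.Structure M]
    [Nonempty M] :
    ∃ χ : L.Formula α, ∀ x : α → M, χ.Realize x ↔ ∃ y : β → M, φ.Realize (Sum.elim x y) := by
  classical
  -- Only the finitely many variables from `β` that occur in `φ` are quantified; the others may take
  -- any value, which exists because `M` is nonempty.
  let γ := {b : β // Sum.inr b ∈ φ.freeVarFinset}
  have : Finite γ := Finite.of_injective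
    (fun b : γ => (⟨Sum.inr b.1, b.2⟩ : φ.freeVarFinset)) fun a b h => by
      exact Subtype.ext (Sum.inr.inj (Subtype.ext_iff.1 h))
  let f : φ.freeVarFinset → α ⊕ γ := fun a =>
    match a with
    | ⟨.inl a, _⟩ => .inl a
    | ⟨.inr b, h⟩ => .inr ⟨b, h⟩
  refine ⟨Formula.iExs γ (BoundedFormula.restrictFreeVar φ f), fun x => ?_⟩
  rw [Formula.realize_iExs]
  constructor
  · rintro ⟨y, hy⟩
    refine ⟨fun b => if h : Sum.inr b ∈ φ.freeVarFinset then y ⟨b, h⟩ else Classical.ofNonempty, ?_⟩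
    refine (BoundedFormula.realize_restrictFreeVar _ ?_).1 hy
    rintro ⟨a | b, h⟩
    · rfl
    · simp [f, h]
  · rintro ⟨y, hy⟩
    refine ⟨fun b => y b, (BoundedFormula.realize_restrictFreeVar _ ?_).2 hy⟩
    rintro ⟨a | b, h⟩ <;> rfl

/-- Compactness: a finitely satisfiable set of formulas is realized in an elementarily equivalent
structure. -/
lemma exists_realize_of_finitely_satisfiable {α : Type} (M : Type w) [L.Structure M] [Nonempty M]
    (Γ : Set (L.Formula α)) (h : ∀ F : Finset (L.Formula α), (∀ φ ∈ F, φ ∈ Γ) →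
      ∃ x : α → M, ∀ φ ∈ F, φ.Realize x) :
    ∃ (N : Type (max u v w)) (_ : L.Structure N) (c : α → N), (M ≅[L] N) ∧
      ∀ φ ∈ Γ, φ.Realize c := by
  classical
  -- An ultrapower indexed by the finite subsets of `Γ`. An ultrafilter finer than `atTop` contains
  -- every cone above `{φ}`, so by Łoś the class of the chosen solutions realizes all of `Γ`.
  let I := Finset Γ
  let U : Ultrafilter I := Ultrafilter.of Filter.atTop
  have hU : (U : Filter I) ≤ Filter.atTop := Ultrafilter.of_le _
  choose x hx using fun F : I => h (F.map (Function.Embedding.subtype _))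
    (by simp +contextual)
  refine ⟨(U : Filter I).Product fun _ => M, inferInstance,
    fun i => ((fun F => x F i : I → M) : (U : Filter I).Product fun _ => M), ?_, ?_⟩
  · refine elementarilyEquivalent_iff.2 fun φ => ?_
    rw [Ultraproduct.sentence_realize]
    simp
  · intro φ hφ
    refine (Ultraproduct.realize_formula_cast φ fun i F => x F i).2 (hU ?_)
    filter_upwards [Filter.eventually_ge_atTop ({⟨φ, hφ⟩} : I)] with F hF
    exact hx F φ (by simpa using ⟨hφ, hF (Finset.mem_singleton_self _)⟩)

end Formulas

/-! ### Omitting types by a generic ideal of formulas -/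

section Omitting

variable {L : FirstOrder.Language.{u, v}} (M : Type w) [L.Structure M]

/-- The satisfiable formulas in countably many variables; stronger formulas are larger. -/
def Condition : Type (max u v) :=
  {φ : L.Formula ℕ // ∃ x : ℕ → M, φ.Realize x}

instance : Preorder (Condition (L := L) M) where
  le φ ψ := ∀ x : ℕ → M, ψ.1.Realize x → φ.1.Realize x
  le_refl _ _ h := h
  le_trans _ _ _ h₁ h₂ x h := h₁ x (h₂ x h)

variable {M}

/-- Conditions that decide whether `φ` has a witness, and in the positive case name one. -/
def witnessSet (φ : L.Formula (ℕ ⊕ Unit)) : Set (Condition (L := L) M) :=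
  {ψ | (∀ x : ℕ → M, ψ.1.Realize x → ∀ a, ¬ φ.Realize (Sum.elim x fun _ => a)) ∨
    ∃ j, ∀ x : ℕ → M, ψ.1.Realize x → φ.Realize (Sum.elim x fun _ => x j)}

lemma comp_elim_id {K : Type*} (x : ℕ → K) (j : ℕ) :
    x ∘ (Sum.elim id fun _ : Unit => j) = Sum.elim x fun _ => x j := by
  ext (_ | _) <;> rfl

/-- If a witness is compatible with the condition, it can be named by a variable `j` that occurs in
neither formula; reassigning `j` then disturbs nothing. -/
lemma isCofinal_witnessSet (φ : L.Formula (ℕ ⊕ Unit)) : IsCofinal (witnessSet (M := M) φ) := by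
  rintro ⟨ψ, hψ⟩
  by_cases h : ∀ x : ℕ → M, ψ.Realize x → ∀ a, ¬ φ.Realize (Sum.elim x fun _ => a)
  · exact ⟨⟨ψ, hψ⟩, Or.inl h, le_refl _⟩
  push Not at h
  obtain ⟨x, hx, a, ha⟩ := h
  obtain ⟨s, hs⟩ := exists_finset_realize_congr ψ M
  obtain ⟨t, ht⟩ := exists_finset_realize_congr φ M
  obtain ⟨j, hj⟩ := Infinite.exists_notMem_finset
    (s ∪ t.preimage Sum.inl Sum.inl_injective.injOn)
  simp only [Finset.mem_union, Finset.mem_preimage, not_or] at hj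
  let χ : L.Formula ℕ := ψ ⊓ φ.relabel (Sum.elim id fun _ => j)
  have hχ : ∀ y : ℕ → M, χ.Realize y ↔ ψ.Realize y ∧ φ.Realize (Sum.elim y fun _ => y j) := by
    intro y
    simp [χ, Formula.realize_inf, Formula.realize_relabel, comp_elim_id]
  refine ⟨(⟨χ, Function.update x j a, (hχ _).2 ⟨?_, ?_⟩⟩ : Condition M), Or.inr ⟨j, fun y hy => ((hχ y).1 hy).2⟩,
    fun y hy => ((hχ y).1 hy).1⟩
  · refine (hs _ x fun i hi => ?_).2 hx
    rw [Function.update_of_ne]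
    rintro rfl
    exact hj.1 hi
  · refine (ht _ (Sum.elim x fun _ => a) ?_).2 ha
    rintro (i | i) hi
    · refine Function.update_of_ne ?_ _ _
      rintro rfl
      exact hj.2 hi
    · simp

/-- A formula is an atom if it isolates a type. -/
def IsAtomFormula (M : Type w) [L.Structure M] {n : ℕ} (χ : L.Formula (Fin n)) : Prop :=
  (∃ x : Fin n → M, χ.Realize x) ∧
    ∀ τ : L.Formula (Fin n), (∀ x : Fin n → M, χ.Realize x → τ.Realize x) ∨
      ∀ x : Fin n → M, χ.Realize x → ¬ τ.Realize x

/-- Conditions that prevent the variables `i` from realizing `p`. -/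
def omitSet {n : ℕ} (p : Set (L.Formula (Fin n))) (i : Fin n → ℕ) : Set (Condition (L := L) M) :=
  {ψ | ∃ σ ∈ p, ∀ x : ℕ → M, ψ.1.Realize x → ¬ σ.Realize (x ∘ i)}

/-- If no extension of `ψ` refutes a member of `p`, then the projection `χ` of `ψ` to the variables
`i` implies all of `p`. As `p` is complete, `χ` is an atom, so `p` contains its negation, which is
absurd since `χ` is satisfiable. -/
lemma isCofinal_omitSet [Nonempty M] {n : ℕ} (p : Set (L.Formula (Fin n)))
    (hp : ∀ τ, τ ∈ p ∨ τ.not ∈ p) (hatom : ∀ χ, IsAtomFormula M χ → χ ∉ p) (i : Fin n → ℕ) :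
    IsCofinal (omitSet (M := M) p i) := by
  rintro ⟨ψ, hψ⟩
  by_cases h : ∃ σ ∈ p, ∃ x : ℕ → M, ψ.Realize x ∧ ¬ σ.Realize (x ∘ i)
  · obtain ⟨σ, hσ, x, hx, hxσ⟩ := h
    have hχ : ∀ y : ℕ → M, (ψ ⊓ (σ.relabel i).not : L.Formula ℕ).Realize y ↔
        ψ.Realize y ∧ ¬ σ.Realize (y ∘ i) := by
      intro y
      simp [Formula.realize_inf, Formula.realize_not, Formula.realize_relabel]
    exact ⟨⟨_, x, (hχ x).2 ⟨hx, hxσ⟩⟩, ⟨σ, hσ, fun y hy => ((hχ y).1 hy).2⟩,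
      fun y hy => ((hχ y).1 hy).1⟩
  push Not at h
  exfalso
  obtain ⟨χ, hχ⟩ := exists_formula_realize_iff_exists (α := Fin n) (β := ℕ)
    (ψ.relabel Sum.inr ⊓ Formula.iInf fun l : Fin n =>
      (Term.var (Sum.inl l)).equal (Term.var (Sum.inr (i l)))) M
  replace hχ : ∀ x : Fin n → M, χ.Realize x ↔ ∃ y : ℕ → M, ψ.Realize y ∧ x = y ∘ i := by
    intro x
    simp [hχ, Formula.realize_inf, Formula.realize_relabel, Formula.realize_iInf, funext_iff,
      Formula.realize_equal]
  have hχp : ∀ σ ∈ p, ∀ x : Fin n → M, χ.Realize x → σ.Realize x := by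
    intro σ hσ x hx
    obtain ⟨y, hy, rfl⟩ := (hχ x).1 hx
    exact h σ hσ y hy
  obtain ⟨y, hy⟩ := hψ
  have hsat : χ.Realize (y ∘ i) := (hχ _).2 ⟨y, hy, rfl⟩
  have hχatom : IsAtomFormula M χ := by
    refine ⟨⟨_, hsat⟩, fun τ => (hp τ).imp (hχp τ) fun hτ x hx => ?_⟩
    simpa using hχp _ hτ x hx
  exact hχp _ ((hp χ).resolve_left (hatom χ hχatom)) _ hsat hsat

/-- The omitting types theorem, for types of tuples that realize no atom. -/
lemma exists_countable_omitting [Countable L.Symbols] [Nonempty M] {n : ℕ}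
    (p : Set (L.Formula (Fin n))) (hp : ∀ τ, τ ∈ p ∨ τ.not ∈ p)
    (hatom : ∀ χ, IsAtomFormula M χ → χ ∉ p) :
    ∃ (N : Type (max u v w)) (_ : L.Structure N), (M ≅[L] N) ∧ Countable N ∧
      ∀ y : Fin n → N, ∃ σ ∈ p, ¬ σ.Realize y := by
  classical
  let ι := L.Formula (ℕ ⊕ Unit) ⊕ (Fin n → ℕ)
  let _ : Encodable ι := Encodable.ofCountable _
  let D : ι → Order.Cofinal (Condition (L := L) M) := Sum.elim
    (fun φ => ⟨witnessSet φ, isCofinal_witnessSet φ⟩)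
    (fun i => ⟨omitSet p i, isCofinal_omitSet p hp hatom i⟩)
  let p₀ : Condition (L := L) M := ⟨⊤, fun _ => Classical.ofNonempty, by simp⟩
  -- Rasiowa–Sikorski: as there are only countably many requirements, one ideal meets them all. Its
  -- consequences form the type of an enumeration `c` of the desired model.
  let G := Order.idealOfCofinals p₀ D
  let Γ : Set (L.Formula ℕ) := {χ | ∃ ψ ∈ G, ∀ x : ℕ → M, ψ.1.Realize x → χ.Realize x}
  have hΓ : ∀ F : Finset (L.Formula ℕ), (∀ φ ∈ F, φ ∈ Γ) →
      ∃ ψ ∈ G, ∀ φ ∈ F, ∀ x : ℕ → M, ψ.1.Realize x → φ.Realize x := by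
    intro F
    induction F using Finset.induction_on with
    | empty =>
      intro _
      obtain ⟨ψ, hψ⟩ := G.nonempty
      exact ⟨ψ, hψ, by simp⟩
    | insert φ F _ ih =>
      intro h
      obtain ⟨ψ, hψ, hF⟩ := ih fun χ hχ => h χ (Finset.mem_insert_of_mem hχ)
      obtain ⟨ψ', hψ', hφ⟩ := h φ (Finset.mem_insert_self _ _)
      obtain ⟨θ, hθ, h₁, h₂⟩ := G.directed ψ hψ ψ' hψ'
      refine ⟨θ, hθ, fun χ hχ x hx => ?_⟩
      rcases Finset.mem_insert.1 hχ with rfl | hχ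
      · exact hφ x (h₂ x hx)
      · exact hF χ hχ x (h₁ x hx)
  obtain ⟨N, _, c, hMN, hc⟩ := exists_realize_of_finitely_satisfiable M Γ fun F hF => by
    obtain ⟨ψ, _, hψ⟩ := hΓ F hF
    obtain ⟨x, hx⟩ := ψ.2
    exact ⟨x, fun φ hφ => hψ φ hφ x hx⟩
  have : Nonempty N := ⟨c 0⟩
  have hwit : ∀ (φ : L.Formula (ℕ ⊕ Unit)) (a : N), φ.Realize (Sum.elim c fun _ => a) →
      ∃ j, φ.Realize (Sum.elim c fun _ => c j) := by
    intro φ a ha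
    obtain ⟨ψ, hψ | ⟨j, hj⟩, hψG⟩ := Order.cofinal_meets_idealOfCofinals
      p₀ D (Sum.inl φ)
    · have := hc (Formula.iExs Unit φ).not ⟨ψ, hψG, fun x hx => by
        rw [Formula.realize_not, Formula.realize_iExs]
        rintro ⟨b, hb⟩
        exact hψ x hx (b ()) hb⟩
      rw [Formula.realize_not, Formula.realize_iExs] at this
      exact absurd ⟨_, ha⟩ this
    · have := hc (φ.relabel (Sum.elim id fun _ => j)) ⟨ψ, hψG, fun x hx => by
        rw [Formula.realize_relabel, comp_elim_id]
        exact hj x hx⟩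
      rw [Formula.realize_relabel, comp_elim_id] at this
      exact ⟨j, this⟩
  let S : L.Substructure N :=
    { carrier := Set.range c
      fun_mem := by
        intro k f x hx
        choose j hj using hx
        obtain rfl : c ∘ j = x := funext hj
        obtain ⟨l, hl⟩ := hwit ((Term.func f fun i => Term.var (Sum.inl (j i))).equal
          (Term.var (Sum.inr ()))) (Structure.funMap f (c ∘ j)) (by
            simp [Formula.realize_equal, Function.comp_def])
        refine ⟨l, ?_⟩
        simpa [Formula.realize_equal, Function.comp_def, eq_comm] using hl }
  -- The Tarski–Vaught test: parameters from the range of `c` can be replaced by variables, and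
  -- `hwit` then provides a witness in the range.
  have hS : S.IsElementary := by
    refine S.isElementary_of_exists fun k φ x a ha => ?_
    choose j hj using fun i => (x i).2
    have hrel : ∀ b : N, Sum.elim c (fun _ : Unit => b) ∘
        (Sum.elim Empty.elim (Fin.snoc (fun i => Sum.inl (j i)) (Sum.inr ())) :
          Empty ⊕ Fin (k + 1) → ℕ ⊕ Unit) ∘ Sum.inr = Fin.snoc ((↑) ∘ x) b := by
      intro b
      ext i
      refine Fin.lastCases ?_ (fun i => ?_) i
      · simp
      · simp [hj]
    have hφ : ∀ b : N, (φ.toFormula.relabel (Sum.elim Empty.elim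
        (Fin.snoc (fun i => Sum.inl (j i)) (Sum.inr ()))) : L.Formula (ℕ ⊕ Unit)).Realize
          (Sum.elim c fun _ => b) ↔ φ.Realize default (Fin.snoc ((↑) ∘ x) b : _ → N) := by
      intro b
      rw [Formula.realize_relabel, BoundedFormula.realize_toFormula, ← hrel b,
        Function.comp_assoc, Function.comp_assoc, Subsingleton.elim (_ ∘ _ ∘ Sum.inl) default]
    obtain ⟨l, hl⟩ := hwit _ a ((hφ a).2 ha)
    exact ⟨⟨c l, l, rfl⟩, (hφ _).1 hl⟩
  let S' : L.ElementarySubstructure N := ⟨S, hS⟩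
  refine ⟨S', inferInstance, hMN.trans S'.elementarilyEquivalent.symm,
    (Set.countable_range c).to_subtype, fun y => ?_⟩
  choose j hj using fun i => (y i).2
  obtain ⟨ψ, ⟨σ, hσ, hψ⟩, hψG⟩ := Order.cofinal_meets_idealOfCofinals
    p₀ D (Sum.inr j)
  refine ⟨σ, hσ, fun hy => ?_⟩
  have := hc (σ.relabel j).not ⟨ψ, hψG, fun x hx => by
    rw [Formula.realize_not, Formula.realize_relabel]
    exact hψ x hx⟩
  rw [Formula.realize_not, Formula.realize_relabel] at this
  refine this ?_
  rw [show c ∘ j = S'.subtype ∘ y from funext hj]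
  exact (S'.subtype.map_formula σ y).2 hy

end Omitting

/-! ### The theorem of Ryll-Nardzewski -/

section Categorical

variable {L : FirstOrder.Language.{u, v}}

/-- Countable structures can be moved to any universe. -/
lemma exists_modelType_equiv {A : Type w} [L.Structure A] [Infinite A] (M : Type*) [L.Structure M]
    [Countable M] (hM : A ≅[L] M) :
    ∃ K : (L.completeTheory A).ModelType, #K = Cardinal.aleph0.{w} ∧ Nonempty (M ≃[L] K) := by
  have : Infinite M := hM.infinite
  obtain ⟨e⟩ : Nonempty (M ≃ ULift.{w} ℕ) := by
    obtain ⟨_⟩ := nonempty_denumerable M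
    exact ⟨(Denumerable.eqv M).trans Equiv.ulift.symm⟩
  let _ : L.Structure (ULift.{w} ℕ) := e.inducedStructure
  let e' : M ≃[L] ULift.{w} ℕ := e.inducedStructureEquiv
  have : ULift.{w} ℕ ⊨ L.completeTheory A :=
    (hM.trans (StrongHomClass.elementarilyEquivalent e')).theory_model
  exact ⟨Theory.ModelType.of _ (ULift.{w} ℕ), by simp, ⟨e'⟩⟩

/-- Countable structures that are elementarily equivalent to an infinite `ω`-categorical structure
are isomorphic. -/
lemma OmegaCategorical.nonempty_equiv {A : Type w} [L.Structure A] [Infinite A]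
    (h : OmegaCategorical L A) {M N : Type*} [L.Structure M] [L.Structure N] [Countable M]
    [Countable N] (hM : A ≅[L] M) (hN : A ≅[L] N) : Nonempty (M ≃[L] N) := by
  obtain ⟨M', hM', ⟨e⟩⟩ := exists_modelType_equiv M hM
  obtain ⟨N', hN', ⟨f⟩⟩ := exists_modelType_equiv N hN
  obtain ⟨g⟩ := h M' N' hM' hN'
  exact ⟨f.symm.comp (g.comp e)⟩

/-- The theorem of Ryll-Nardzewski: in an `ω`-categorical structure, finitely many tuples represent
all types of tuples. -/
theorem OmegaCategorical.exists_finite_types [Countable L.Symbols] {A : Type w} [L.Structure A]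
    [Nonempty A] (h : OmegaCategorical L A) (n : ℕ) :
    ∃ S : Set (Fin n → A), S.Finite ∧
      ∀ x : Fin n → A, ∃ y ∈ S, ∀ φ : L.Formula (Fin n), φ.Realize x ↔ φ.Realize y := by
  classical
  cases finite_or_infinite A with
  | inl _ => exact ⟨Set.univ, Set.finite_univ, fun x => ⟨x, trivial, fun _ => Iff.rfl⟩⟩
  | inr _ =>
  by_cases hcov : ∃ F : Finset (L.Formula (Fin n)), (∀ χ ∈ F, IsAtomFormula A χ) ∧
      ∀ x : Fin n → A, ∃ χ ∈ F, χ.Realize x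
  · obtain ⟨F, hF, hcov⟩ := hcov
    choose r hr using fun χ : F => (hF χ χ.2).1
    refine ⟨Set.range r, Set.finite_range r, fun x => ?_⟩
    obtain ⟨χ, hχ, hx⟩ := hcov x
    refine ⟨_, ⟨⟨χ, hχ⟩, rfl⟩, fun φ => ?_⟩
    have hrχ := hr ⟨χ, hχ⟩
    rcases (hF χ hχ).2 φ with hφ | hφ
    · exact iff_of_true (hφ _ hx) (hφ _ hrχ)
    · exact iff_of_false (hφ _ hx) (hφ _ hrχ)
  exfalso
  push Not at hcov
  -- If no finite set of atoms covers all tuples, the negations of all atoms are finitely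
  -- satisfiable. Some countable model then realizes a type without atoms, and another one omits
  -- this type, so the two cannot be isomorphic.
  let Γ : Set (L.Formula (Fin n)) := {τ | ∃ χ, IsAtomFormula A χ ∧ τ = χ.not}
  obtain ⟨N, _, d, hAN, hd⟩ := exists_realize_of_finitely_satisfiable A Γ fun F hF => by
    choose χ hχ hτ using hF
    obtain ⟨x, hx⟩ := hcov (F.attach.image fun τ : F => χ τ τ.2) (by
      simp only [Finset.mem_image, Finset.mem_attach, true_and]
      rintro _ ⟨τ, rfl⟩
      exact hχ _ _)
    refine ⟨x, fun τ hτF => ?_⟩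
    rw [hτ τ hτF, Formula.realize_not]
    exact hx _ (Finset.mem_image_of_mem (fun τ : F => χ τ τ.2) (Finset.mem_attach _ ⟨τ, hτF⟩))
  have : Infinite N := hAN.infinite
  obtain ⟨S, hdS, hS⟩ := exists_elementarySubstructure_card_eq L (Set.range d)
    Cardinal.aleph0.{0} le_rfl (by simp) (by
      have : L.card ≤ ℵ₀ := Cardinal.mk_le_aleph0_iff.2 ‹_›
      rw [Cardinal.lift_aleph0]
      exact Cardinal.lift_le_aleph0.2 this) (by simp)
  have : Countable S := by
    rw [← Cardinal.mk_le_aleph0_iff]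
    simpa using hS.le
  let d₀ : Fin n → S := fun i => ⟨d i, hdS ⟨i, rfl⟩⟩
  have hd₀ : ∀ φ : L.Formula (Fin n), φ.Realize d ↔ φ.Realize d₀ :=
    fun φ => S.subtype.map_formula φ d₀
  obtain ⟨K, _, hAK, _, hK⟩ := exists_countable_omitting (M := A) {σ : L.Formula (Fin n) | σ.Realize d₀}
    (fun τ => by
      simp only [Set.mem_ofPred_eq, Formula.realize_not]
      exact em _) fun χ hχ => by
      have := hd χ.not ⟨χ, hχ, rfl⟩
      rwa [Formula.realize_not, hd₀] at this
  obtain ⟨g⟩ := h.nonempty_equiv (M := S) (N := K) (hAN.trans S.elementarilyEquivalent.symm) hAK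
  obtain ⟨σ, hσ, hσK⟩ := hK (g ∘ d₀)
  exact hσK ((StrongHomClass.realize_formula g σ).2 hσ)

end Categorical
end CspEq

namespace CspEq

universe u v w

/-! ### Stack machines and their translation to oracle machines -/

section StackMachines

/-- Instructions of stack machines: pop a symbol from a stack and, depending on it, push finitely
many symbols and jump; ask the oracle about the word on the query stack; halt. -/
inductive Instr (K : Type) (Γ : Type u) (Λ : Type) : Type u
  | pop (k : K) (f : Option Γ → List (K × Γ) × Λ)
  | ask (yes no : Λ)
  | halt (b : Bool)

/-- Stack machines with an oracle whose finite control is contained in the labels. -/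
structure StackMachine (Γin Γq : Type u) where
  K : Type
  [decEqK : DecidableEq K]
  [finK : Finite K]
  Γ : Type u
  [finΓ : Finite Γ]
  Λ : Type
  [finΛ : Finite Λ]
  inLetter : Γin ↪ Γ
  qLetter : Γq ↪ Γ
  inputStack : K
  queryStack : K
  main : Λ
  instr : Λ → Instr K Γ Λ

attribute [instance] StackMachine.decEqK StackMachine.finK StackMachine.finΓ StackMachine.finΛ

/-- Push symbols onto stacks, one after the other. -/
def pushAll {K Γ : Type*} [DecidableEq K] (ps : List (K × Γ)) (S : K → List Γ) : K → List Γ :=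
  ps.foldl (fun S p => Function.update S p.1 (p.2 :: S p.1)) S

namespace StackMachine

variable {Γin Γq : Type u} (M : StackMachine Γin Γq) (Y : Set (List Γq))

/-- Configurations that have not halted. -/
abbrev Conf : Type u := M.Λ × (M.K → List M.Γ)

open Classical in
/-- The successor of a configuration. -/
noncomputable def next (c : M.Conf) : M.Conf :=
  match M.instr c.1 with
  | .pop k f => ((f (c.2 k).head?).2,
      pushAll (f (c.2 k).head?).1 (Function.update c.2 k (c.2 k).tail))
  | .ask yes no => (if ∃ w ∈ Y, c.2 M.queryStack = w.map M.qLetter then yes else no,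
      Function.update c.2 M.queryStack [])
  | .halt _ => c

/-- `M.Run Y t c d` means that `d` is reached from `c` in at most `t` steps. -/
inductive Run : ℕ → M.Conf → M.Conf → Prop
  | refl (t : ℕ) (c : M.Conf) : Run t c c
  | head {t : ℕ} {c d : M.Conf} (hc : ∀ b, M.instr c.1 ≠ .halt b) (h : Run t (M.next Y c) d) :
    Run (t + 1) c d

variable {M Y}

lemma Run.mono {s t : ℕ} {c d : M.Conf} (h : M.Run Y s c d) (hst : s ≤ t) : M.Run Y t c d := by
  induction h generalizing t with
  | refl => exact .refl _ _
  | head hc _ ih =>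
    obtain ⟨t, rfl⟩ := Nat.exists_eq_add_of_le' (Nat.one_le_of_lt (Nat.lt_of_succ_le hst))
    exact .head hc (ih (by omega))

lemma Run.trans {s t : ℕ} {c d e : M.Conf} (h₁ : M.Run Y s c d) (h₂ : M.Run Y t d e) :
    M.Run Y (s + t) c e := by
  induction h₁ with
  | refl => exact h₂.mono (by omega)
  | head hc _ ih => exact (Run.head hc (ih h₂)).mono (by omega)

lemma Run.pop {t : ℕ} {l l' : M.Λ} {S : M.K → List M.Γ} {d : M.Conf} {k : M.K}
    {f : Option M.Γ → List (M.K × M.Γ) × M.Λ} {ps : List (M.K × M.Γ)} (hl : M.instr l = .pop k f)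
    (hf : f (S k).head? = (ps, l'))
    (h : M.Run Y t (l', pushAll ps (Function.update S k (S k).tail)) d) :
    M.Run Y (t + 1) (l, S) d :=
  .head (by simp [hl]) (by simpa only [next, hl, hf] using h)

open Classical in
lemma Run.ask {t : ℕ} {l yes no : M.Λ} {S : M.K → List M.Γ} {d : M.Conf}
    (hl : M.instr l = .ask yes no)
    (h : M.Run Y t (if ∃ w ∈ Y, S M.queryStack = w.map M.qLetter then yes else no,
      Function.update S M.queryStack []) d) :
    M.Run Y (t + 1) (l, S) d :=
  .head (by simp [hl]) (by simpa only [next, hl] using h)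

section Compile

open Turing.TM2 (Stmt stepAux)

variable {K Γ Λ σ : Type} [DecidableEq K]

/-- Statement that pushes a list of symbols. -/
def pushStmt (ps : List (K × Γ)) (q : Stmt (fun _ : K => Γ) Λ σ) : Stmt (fun _ : K => Γ) Λ σ :=
  ps.foldr (fun p q => .push p.1 (fun _ => p.2) q) q

lemma stepAux_pushStmt (ps : List (K × Γ)) (q : Stmt (fun _ : K => Γ) Λ σ) (v : σ)
    (S : K → List Γ) : stepAux (pushStmt ps q) v S = stepAux q v (pushAll ps S) := by
  induction ps generalizing S with
  | nil => rfl
  | cons p ps ih => exact ih _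

open Classical in
/-- Statement that distinguishes cases according to the last symbol read. -/
noncomputable def caseStmt (cs : List (Option Γ)) (g : Option Γ → Stmt (fun _ : K => Γ) Λ (Option Γ × Bool)) :
    Stmt (fun _ : K => Γ) Λ (Option Γ × Bool) :=
  cs.foldr (fun o q => .branch (fun v => decide (v.1 = o)) (g o) q) .halt

lemma stepAux_caseStmt {cs : List (Option Γ)}
    (g : Option Γ → Stmt (fun _ : K => Γ) Λ (Option Γ × Bool)) {v : Option Γ × Bool}
    (hv : v.1 ∈ cs) (S : K → List Γ) : stepAux (caseStmt cs g) v S = stepAux (g v.1) v S := by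
  induction cs with
  | nil => simp at hv
  | cons o cs ih =>
    by_cases h : v.1 = o
    · simp [caseStmt, h]
    · have := ih ((List.mem_cons.1 hv).resolve_left h)
      simpa [caseStmt, h] using this

lemma pushAll_map {Γ' : Type u} (e : Γ' → Γ) (ps : List (K × Γ')) (S : K → List Γ') :
    pushAll (ps.map (Prod.map id e)) (fun k => (S k).map e) = fun k => (pushAll ps S k).map e := by
  induction ps generalizing S with
  | nil => rfl
  | cons p ps ih =>
    simp only [pushAll, List.map_cons, List.foldl_cons] at ih ⊢
    rw [← ih]
    congr 1
    ext1 k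
    by_cases hk : k = p.1
    · subst hk; simp
    · simp [hk]

end Compile

variable (M)

/-- The number of symbols of a stack machine. -/
noncomputable def symbolEquiv : M.Γ ≃ Fin (Nat.card M.Γ) := Finite.equivFin _

/-- The statement that carries out an instruction other than a query. -/
noncomputable def compile {K Γ' Λ : Type} {Γ : Type u} [Fintype Γ'] (e : Γ ≃ Γ') :
    Instr K Γ Λ → Turing.TM2.Stmt (fun _ : K => Γ') Λ (Option Γ' × Bool)
  | .pop k f => .pop k (fun _ o => (o, false)) (caseStmt Finset.univ.toList fun o =>
      pushStmt ((f (o.map e.symm)).1.map (Prod.map id e)) (.goto fun _ => (f (o.map e.symm)).2))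
  | .ask _ _ => .halt
  | .halt b => .load (fun _ => (none, b)) .halt

/-- The oracle machine that simulates a stack machine. -/
@[reducible]
noncomputable def toOracleTM : OracleTM Γin Γq where
  K := M.K
  Γ := Fin (Nat.card M.Γ)
  Λ := M.Λ
  σ := Option (Fin (Nat.card M.Γ)) × Bool
  inLetter := M.inLetter.trans M.symbolEquiv.toEmbedding
  qLetter := M.qLetter.trans M.symbolEquiv.toEmbedding
  inputStack := M.inputStack
  queryStack := M.queryStack
  main := M.main
  initialState := (none, false)
  prog l := compile M.symbolEquiv (M.instr l)
  ask l :=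
    match M.instr l with
    | .ask yes no => some (yes, no)
    | _ => none
  accept v := v.2

variable {M}

lemma _root_.CspEq.OracleTM.step_of_ask_eq_none {M : OracleTM Γin Γq} {l : M.Λ}
    (h : M.ask l = none) (v : M.σ) (S : M.K → List M.Γ) :
    M.step Y ⟨some l, v, S⟩ = some (Turing.TM2.stepAux (M.prog l) v S) := by
  simp only [OracleTM.step, h]

open Classical in
lemma _root_.CspEq.OracleTM.step_of_ask_eq_some {M : OracleTM Γin Γq} {l yes no : M.Λ}
    (h : M.ask l = some (yes, no)) (v : M.σ) (S : M.K → List M.Γ) :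
    M.step Y ⟨some l, v, S⟩ =
      some ⟨some (if ∃ w ∈ Y, S M.queryStack = w.map M.qLetter then yes else no), v,
        Function.update S M.queryStack []⟩ := by
  simp only [OracleTM.step, h]

lemma map_update {K Γ Γ' : Type*} [DecidableEq K] (e : Γ → Γ') (S : K → List Γ) (k : K)
    (w : List Γ) : (fun j => (Function.update S k w j).map e) =
      Function.update (fun j => (S j).map e) k (w.map e) := by
  ext1 j
  by_cases hj : j = k
  · subst hj; simp
  · simp [hj]

/-- A single `TM2` statement can pop, distinguish all symbols and push, so each instruction costs
exactly one step. The internal state only remembers the last symbol read and is overwritten by the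
next pop, hence its value does not matter. -/
lemma toOracleTM_step (c : M.Conf) (hc : ∀ b, M.instr c.1 ≠ .halt b)
    (v : Option (Fin (Nat.card M.Γ)) × Bool) :
    ∃ v', M.toOracleTM.step Y ⟨some c.1, v, fun k => (c.2 k).map M.symbolEquiv⟩ =
      some ⟨some (M.next Y c).1, v', fun k => ((M.next Y c).2 k).map M.symbolEquiv⟩ := by
  obtain ⟨l, S⟩ := c
  cases hl : M.instr l with
  | pop k f =>
    refine ⟨((S k).head?.map M.symbolEquiv, false), ?_⟩
    have hask : M.toOracleTM.ask l = none := by simp [hl]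
    have h₂ : ((S k).head?.map M.symbolEquiv).map M.symbolEquiv.symm = (S k).head? := by
      cases (S k).head? <;> simp
    rw [OracleTM.step_of_ask_eq_none hask]
    simp only [next, hl, compile, Turing.TM2.stepAux]
    rw [stepAux_caseStmt _ (by simp), stepAux_pushStmt]
    simp only [Turing.TM2.stepAux, List.head?_map]
    rw [h₂, ← pushAll_map, map_update, List.map_tail]
  | ask yes no =>
    refine ⟨v, ?_⟩
    have hask : M.toOracleTM.ask l = some (yes, no) := by simp [hl]
    have h₁ : ∀ w : List Γq, List.map (⇑M.symbolEquiv) (S M.queryStack) =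
        w.map (M.qLetter.trans M.symbolEquiv.toEmbedding) ↔ S M.queryStack = w.map M.qLetter := by
      intro w
      have : w.map (M.qLetter.trans M.symbolEquiv.toEmbedding) =
          (w.map M.qLetter).map M.symbolEquiv := by
        rw [List.map_map]; rfl
      rw [this, (List.map_injective_iff.2 M.symbolEquiv.injective).eq_iff]
    rw [OracleTM.step_of_ask_eq_some hask]
    simp only [next, hl, map_update, List.map_nil]
    congr! 4
    exact exists_congr fun w => and_congr_right fun _ => h₁ w
  | halt b => exact absurd hl (hc b)

lemma Run.evalsTo {t : ℕ} {c d : M.Conf} (h : M.Run Y t c d)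
    (v : Option (Fin (Nat.card M.Γ)) × Bool) :
    ∃ v', Nonempty (StateTransition.EvalsToInTime (M.toOracleTM.step Y)
      ⟨some c.1, v, fun k => (c.2 k).map M.symbolEquiv⟩
      (some ⟨some d.1, v', fun k => (d.2 k).map M.symbolEquiv⟩) t) := by
  induction h generalizing v with
  | refl t c => exact ⟨v, ⟨⟨⟨0, rfl⟩, Nat.zero_le _⟩⟩⟩
  | @head t c d hc _ ih =>
    obtain ⟨v', hv'⟩ := toOracleTM_step (Y := Y) c hc v
    obtain ⟨v'', ⟨h⟩⟩ := ih v'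
    exact ⟨v'', ⟨.trans _ 1 t _ _ _ ⟨⟨1, hv'⟩, le_rfl⟩ h⟩⟩

/-- Reductions can be carried out by stack machines. -/
theorem polyTimeReducible {X Y : DecisionProblem.{u}} (M : StackMachine X.Letter Y.Letter)
    (p : Polynomial ℕ)
    (h : ∀ x, ∃ d b, M.Run Y.language (p.eval (X.encode x).length)
      (M.main, Function.update (fun _ => []) M.inputStack ((X.encode x).map M.inLetter)) d ∧
      M.instr d.1 = .halt b ∧ (b = true ↔ X.Yes x)) : PolyTimeReducible X Y := by
  -- A run ends in front of the halting instruction; the additional step executes it.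
  refine ⟨M.toOracleTM, p + 1, fun x => ?_⟩
  obtain ⟨d, b, hrun, hd, hb⟩ := h x
  obtain ⟨v, ⟨hv⟩⟩ := hrun.evalsTo (none, false)
  refine ⟨⟨none, (none, b), fun k => (d.2 k).map M.symbolEquiv⟩, ⟨?_⟩, rfl, hb⟩
  have hinit : M.toOracleTM.init (X.encode x) = ⟨some M.main, (none, false), fun k =>
      (Function.update (fun _ => []) M.inputStack ((X.encode x).map M.inLetter) k).map
        M.symbolEquiv⟩ := by
    rw [map_update, List.map_map]
    rfl
  have hlast : M.toOracleTM.step Y.language ⟨some d.1, v, fun k => (d.2 k).map M.symbolEquiv⟩ =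
      some ⟨none, (none, b), fun k => (d.2 k).map M.symbolEquiv⟩ := by
    rw [OracleTM.step_of_ask_eq_none (by simp [hd])]
    simp only [hd, compile, Turing.TM2.stepAux]
  rw [hinit]
  have := StateTransition.EvalsToInTime.trans _ _ 1 _ _ _ hv ⟨⟨1, hlast⟩, le_rfl⟩
  refine ⟨this.toEvalsTo, this.steps_le_m.trans ?_⟩
  simp [add_comm]

end StackMachine

end StackMachines
end CspEq

namespace CspEq

universe u v w

/-! ### Finite state transducers -/

section Transducers

/-- Finite state transducers without initial state. -/
structure Transducer (Γ₁ Γ₂ : Type u) where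
  Q : Type
  [finQ : Finite Q]
  δ : Q → Γ₁ → Q × List Γ₂
  final : Q → List Γ₂

attribute [instance] Transducer.finQ

namespace Transducer

variable {Γ₁ Γ₂ : Type u} (T : Transducer Γ₁ Γ₂)

/-- The output of a transducer. -/
def run : T.Q → List Γ₁ → List Γ₂
  | q, [] => T.final q
  | q, a :: w => (T.δ q a).2 ++ run (T.δ q a).1 w

/-- There are finitely many transitions, so each letter contributes a bounded amount of output. This
bounds the time needed to write a query. -/
lemma exists_length_run_le [Finite Γ₁] : ∃ C, ∀ q w, (T.run q w).length ≤ C * (w.length + 1) := by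
  obtain ⟨C₁, h₁⟩ := (Set.finite_range fun p : T.Q × Γ₁ => (T.δ p.1 p.2).2.length).bddAbove
  obtain ⟨C₂, h₂⟩ := (Set.finite_range fun q : T.Q => (T.final q).length).bddAbove
  refine ⟨C₁ + C₂, fun q w => ?_⟩
  induction w generalizing q with
  | nil =>
    have := h₂ ⟨q, rfl⟩
    simp only [run, List.length_nil]
    linarith
  | cons a w ih =>
    have h := h₁ ⟨(q, a), rfl⟩
    have := ih (T.δ q a).1
    simp only [run, List.length_append, List.length_cons] at h ⊢
    linarith

end Transducer

/-- The word `u a v` with its letter `a` marked. -/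
def markedWord {Γ : Type*} (u : List Γ) (a : Γ) (v : List Γ) : List (Bool × Γ) :=
  u.map (Prod.mk false) ++ (true, a) :: v.map (Prod.mk false)

end Transducers

/-! ### The machine that asks transducer queries at every position -/

section PositionMachine

/-- The contents of the position machine. -/
inductive StackName
  | input | left | work | query
  deriving DecidableEq

open StackName

instance : Finite StackName := by
  let f : StackName → Fin 4
    | input => 0
    | left => 1
    | work => 2
    | query => 3
  refine Finite.of_injective f fun a b h => ?_
  cases a <;> cases b <;> simp_all [f]

/-- The labels of the position machine. -/
inductive PosLabel (k : ℕ) (Q : Type)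
  | next | rewind (m : Fin (k + 1)) | scan (m : Fin (k + 1)) (q : Q) | flush (m : Fin (k + 1))
  | ask (m : Fin (k + 1)) | back | accept | reject

open PosLabel

instance (k : ℕ) (Q : Type) [Finite Q] : Finite (PosLabel k Q) := by
  let f : PosLabel k Q → Fin 8 × Fin (k + 1) × Option Q
    | next => (0, 0, none)
    | rewind m => (1, m, none)
    | scan m q => (2, m, some q)
    | flush m => (3, m, none)
    | ask m => (4, m, none)
    | back => (5, 0, none)
    | accept => (6, 0, none)
    | reject => (7, 0, none)
  refine Finite.of_injective f fun a b h => ?_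
  cases a <;> cases b <;> simp_all [f]

variable {Γ₁ Γ₂ : Type u} [Finite Γ₁] [Finite Γ₂] (T : Transducer (Bool × Γ₁) Γ₂) {k : ℕ}
  (q₀ : Fin (k + 1) → T.Q) (start : Γ₁ → Fin (k + 1))

/-- The instructions of the position machine. It goes through the positions of the input; for the
letter `a` at the current position, it looks for a number `m` with `start a ≤ m < k` such that
the oracle accepts the output of the transducer, started in `q₀ m`, on the input with this position
marked. -/
def posInstr : PosLabel k T.Q → Instr StackName ((Bool × Γ₁) ⊕ Γ₂) (PosLabel k T.Q)
  | next => .pop input fun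
    | none => ([], accept)
    -- The mark serves two purposes: the transducer sees the current position, and `back` finds it
    -- again.
    | some (.inl (_, a)) => ([(left, .inl (true, a))], rewind (start a))
    | some (.inr _) => ([], reject)
  | rewind m => .pop left fun
    | none => ([], if m = Fin.last k then reject else scan m (q₀ m))
    | some s => ([(input, s)], rewind m)
  | scan m q => .pop input fun
    | none => ((T.final q).map fun b => (work, .inr b), flush m)
    | some (.inl s) => ((left, .inl s) :: (T.δ q s).2.map fun b => (work, .inr b),
        scan m (T.δ q s).1)
    | some (.inr _) => ([], reject)
  -- The output was pushed in reverse order; moving it to the query stack brings its first letter to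
  -- the top.
  | flush m => .pop work fun
    | none => ([], ask m)
    | some s => ([(query, s)], flush m)
  -- No wrap-around occurs in `m + 1`, since `rewind` starts a scan only if `m` is not the last
  -- index.
  | ask m => .ask back (rewind (m + 1))
  | back => .pop left fun
    | none => ([], reject)
    | some (.inl (true, a)) => ([(left, .inl (false, a))], next)
    | some (.inl (false, a)) => ([(input, .inl (false, a))], back)
    | some (.inr _) => ([], reject)
  | accept => .halt true
  | reject => .halt false

/-- The position machine. -/
@[reducible]
def posMachine : StackMachine Γ₁ Γ₂ where
  K := StackName
  Γ := (Bool × Γ₁) ⊕ Γ₂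
  Λ := PosLabel k T.Q
  inLetter := ⟨fun a => .inl (false, a), fun a b h => by simpa using h⟩
  qLetter := ⟨Sum.inr, Sum.inr_injective⟩
  inputStack := input
  queryStack := query
  main := next
  instr := posInstr T q₀ start

/-- The stack contents of the position machine. -/
def contents {Γ : Type*} (i l w q : List Γ) : StackName → List Γ
  | input => i
  | left => l
  | work => w
  | query => q

section contents

variable {Γ : Type*} (i l w q x : List Γ)

@[simp] lemma update_contents_input : Function.update (contents i l w q) input x = contents x l w q := by
  ext1 j; cases j <;> rfl

@[simp] lemma update_contents_left : Function.update (contents i l w q) left x = contents i x w q := by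
  ext1 j; cases j <;> rfl

@[simp] lemma update_contents_work : Function.update (contents i l w q) work x = contents i l x q := by
  ext1 j; cases j <;> rfl

@[simp] lemma update_contents_query : Function.update (contents i l w q) query x = contents i l w x := by
  ext1 j; cases j <;> rfl

lemma pushAll_work {Γ' : Type*} (f : Γ' → Γ) (ys : List Γ') :
    pushAll (ys.map fun y => (work, f y)) (contents i l w q) =
      contents i l (ys.reverse.map f ++ w) q := by
  induction ys generalizing w with
  | nil => rfl
  | cons y ys ih =>
    simp only [pushAll, List.map_cons, List.foldl_cons, update_contents_work] at ih ⊢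
    rw [ih]
    simp [contents]

end contents

variable {T q₀ start} {Y : Set (List Γ₂)}

local notation "Runs" => StackMachine.Run (posMachine T q₀ start) Y

lemma run_rewind (m : Fin (k + 1)) (i l : List ((Bool × Γ₁) ⊕ Γ₂)) :
    Runs (l.length + 1) (rewind m, contents i l [] [])
      (if m = Fin.last k then reject else scan m (q₀ m), contents (l.reverse ++ i) [] [] []) := by
  induction l generalizing i with
  | nil =>
    refine .pop (k := left) rfl rfl ?_
    simpa [contents, pushAll] using .refl _ _
  | cons s l ih =>
    refine .pop (k := left) rfl rfl ?_
    simpa [contents, pushAll] using ih (s :: i)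

lemma run_scan (m : Fin (k + 1)) (q : T.Q) (w : List (Bool × Γ₁))
    (l x : List ((Bool × Γ₁) ⊕ Γ₂)) :
    Runs (w.length + 1) (scan m q, contents (w.map .inl) l x [])
      (flush m, contents [] (w.reverse.map .inl ++ l) ((T.run q w).reverse.map .inr ++ x) []) := by
  induction w generalizing q l x with
  | nil =>
    refine .pop (k := input) rfl rfl ?_
    simpa [contents, pushAll_work, Transducer.run] using .refl _ _
  | cons a w ih =>
    refine .pop (k := input) rfl rfl ?_
    have := ih (T.δ q a).1 (.inl a :: l) ((T.δ q a).2.reverse.map .inr ++ x)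
    have h : pushAll ((left, .inl a) :: (T.δ q a).2.map fun b => (work, .inr b))
        (contents (w.map .inl) l x []) =
        contents (w.map .inl) (.inl a :: l) ((T.δ q a).2.reverse.map .inr ++ x) [] := by
      rw [← pushAll_work]
      simp [pushAll, contents]
    simpa [contents, h, Transducer.run] using this

lemma run_flush (m : Fin (k + 1)) (i l w x : List ((Bool × Γ₁) ⊕ Γ₂)) :
    Runs (w.length + 1) (flush m, contents i l w x) (ask m, contents i l [] (w.reverse ++ x)) := by
  induction w generalizing x with
  | nil =>
    refine .pop (k := work) rfl rfl ?_
    simpa [contents, pushAll] using .refl _ _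
  | cons s w ih =>
    refine .pop (k := work) rfl rfl ?_
    simpa [contents, pushAll] using ih (s :: x)

lemma run_back (a : Γ₁) (v : List Γ₁) (i l : List ((Bool × Γ₁) ⊕ Γ₂)) :
    Runs (v.length + 1)
      (back, contents i (v.reverse.map (fun b => .inl (false, b)) ++ .inl (true, a) :: l) [] [])
      (next, contents (v.map (fun b => .inl (false, b)) ++ i) (.inl (false, a) :: l) [] []) := by
  induction v using List.reverseRecOn generalizing i with
  | nil =>
    refine .pop (k := left) rfl rfl ?_
    simpa [contents, pushAll] using .refl _ _
  | append_singleton v b ih =>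
    rw [List.length_append]
    refine .pop (k := left) rfl rfl ?_
    simpa [contents, pushAll] using ih (.inl (false, b) :: i)

open Classical in
-- Induction on the number `j` of candidates left. One attempt consists of rewinding, scanning,
-- flushing and asking, which gives the factor of `j`; the last rewinding runs out of candidates.
-- The split of the word between the two stacks is left open because the first attempt and the later
-- ones start from different splits.
lemma run_try {C : ℕ} (hC : ∀ q w, (T.run q w).length ≤ C * (w.length + 1))
    (w : List (Bool × Γ₁)) (j : ℕ) : ∀ (m : Fin (k + 1)), m + j = k →
    ∀ (i l : List ((Bool × Γ₁) ⊕ Γ₂)), l.reverse ++ i = w.map .inl → ∃ S,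
    Runs (w.length + 1 + j * (2 * (w.length + 1) + C * (w.length + 1) + 2))
      (rewind m, contents i l [] [])
      (if ∃ m', m ≤ m' ∧ m' ≠ Fin.last k ∧ T.run (q₀ m') w ∈ Y then
        (back, contents [] (w.reverse.map .inl) [] []) else (reject, S)) := by
  induction j with
  | zero =>
    intro m hm i l hil
    obtain rfl : m = Fin.last k := Fin.ext hm
    refine ⟨contents (l.reverse ++ i) [] [] [], ?_⟩
    rw [if_neg]
    · have hl : l.length ≤ w.length := by
        have := congrArg List.length hil
        simp only [List.length_append, List.length_reverse, List.length_map] at this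
        omega
      have := run_rewind (q₀ := q₀) (start := start) (Y := Y) (Fin.last k) i l
      rw [if_pos rfl] at this
      exact this.mono (by omega)
    · rintro ⟨m, hm, hm', _⟩
      exact hm' (le_antisymm (Fin.le_last m) hm)
  | succ j ih =>
    intro m hm i l hil
    have hmk : m ≠ Fin.last k := by
      rintro rfl
      simp at hm
    have hl : l.length ≤ w.length := by
      have := congrArg List.length hil
      simp only [List.length_append, List.length_reverse, List.length_map] at this
      omega
    have h₁ := (run_rewind (q₀ := q₀) (start := start) (Y := Y) m i l)
    rw [if_neg hmk, hil] at h₁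
    have h₂ := (h₁.trans (run_scan m (q₀ m) w [] [])).trans (run_flush m _ _ _ _)
    simp only [List.append_nil, List.length_map, List.length_reverse, List.map_reverse,
      List.reverse_reverse] at h₂
    have hlen := hC (q₀ m) w
    have hq : (∃ w' ∈ Y, (T.run (q₀ m) w).map (Sum.inr : _ → (Bool × Γ₁) ⊕ Γ₂) =
        w'.map (posMachine T q₀ start).qLetter) ↔ T.run (q₀ m) w ∈ Y := by
      constructor
      · rintro ⟨w', hw', h⟩
        rwa [List.map_injective_iff.2 Sum.inr_injective h]
      · exact fun h => ⟨_, h, rfl⟩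
    by_cases h : T.run (q₀ m) w ∈ Y
    · refine ⟨contents [] [] [] [], ?_⟩
      rw [if_pos ⟨m, le_rfl, hmk, h⟩]
      refine (h₂.trans (.ask (t := 0) rfl ?_)).mono (t := _) ?_
      · change Runs 0 (if ∃ w' ∈ Y, (T.run (q₀ m) w).map (Sum.inr : _ → (Bool × Γ₁) ⊕ Γ₂) =
          w'.map (posMachine T q₀ start).qLetter then _ else _, Function.update _ query []) _
        rw [if_pos (hq.2 h), update_contents_query, List.map_reverse]
        exact .refl _ _
      · nlinarith
    · have hm1 : ((m + 1 : Fin (k + 1)) : ℕ) = m + 1 := by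
        rw [Fin.val_add_one, if_neg hmk]
      obtain ⟨S, hS⟩ := ih (m + 1) (by omega) [] (w.reverse.map .inl) (by simp)
      refine ⟨S, ?_⟩
      have hiff : (∃ m', m ≤ m' ∧ m' ≠ Fin.last k ∧ T.run (q₀ m') w ∈ Y) ↔
          ∃ m', m + 1 ≤ m' ∧ m' ≠ Fin.last k ∧ T.run (q₀ m') w ∈ Y := by
        refine exists_congr fun m' => ⟨?_, ?_⟩
        · rintro ⟨h₁, h₂, h₃⟩
          refine ⟨?_, h₂, h₃⟩
          have : m ≠ m' := by
            rintro rfl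
            exact h h₃
          rw [Fin.le_def, hm1]
          have := lt_of_le_of_ne h₁ this
          rw [Fin.lt_def] at this
          omega
        · rintro ⟨h₁, h₂⟩
          refine ⟨?_, h₂⟩
          rw [Fin.le_def, hm1] at h₁
          rw [Fin.le_def]
          omega
      simp only [hiff]
      refine (h₂.trans (.ask
        (t := w.length + 1 + j * (2 * (w.length + 1) + C * (w.length + 1) + 2)) rfl ?_)).mono ?_
      · change Runs _ (if ∃ w' ∈ Y, (T.run (q₀ m) w).map (Sum.inr : _ → (Bool × Γ₁) ⊕ Γ₂) =
          w'.map (posMachine T q₀ start).qLetter then _ else _, Function.update _ query []) _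
        rw [if_neg (fun h' => h (hq.1 h')), update_contents_query]
        rw [List.map_reverse] at hS ⊢
        exact hS
      · nlinarith

open Classical in
-- The word `u` has been dealt with and `v` remains. Each position costs one pop, the attempts, and
-- the way back to the mark; a position without a successful query rejects at once. So the machine
-- evaluates a conjunction over positions of disjunctions over candidates.
lemma run_next {C : ℕ} (hC : ∀ q w, (T.run q w).length ≤ C * (w.length + 1)) (N : ℕ)
    (v : List Γ₁) : ∀ u : List Γ₁, u.length + v.length = N → ∃ S,
    Runs (v.length * (2 * N + 3 + k * (2 * (N + 1) + C * (N + 1) + 2)) + 1)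
      (next, contents (v.map fun b => .inl (false, b)) (u.reverse.map fun b => .inl (false, b))
        [] [])
      (if ∀ v₁ a v₂, v = v₁ ++ a :: v₂ → ∃ m, start a ≤ m ∧ m ≠ Fin.last k ∧
        T.run (q₀ m) (markedWord (u ++ v₁) a v₂) ∈ Y then accept else reject, S) := by
  induction v with
  | nil =>
    intro u _
    refine ⟨contents [] (u.reverse.map fun b => .inl (false, b)) [] [], ?_⟩
    rw [if_pos (by simp)]
    refine .pop (k := input) rfl rfl ?_
    simpa [pushAll] using .refl _ _
  | cons a v ih =>
    intro u hN
    have hw : (markedWord u a v).length = N := by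
      rw [← hN]
      simp [markedWord]
    have hstart : (start a : ℕ) + (k - start a) = k := by omega
    obtain ⟨S₁, hS₁⟩ := run_try (q₀ := q₀) (start := start) (Y := Y) hC (markedWord u a v)
      (k - start a) (start a) hstart (v.map fun b => .inl (false, b))
      (.inl (true, a) :: u.reverse.map fun b => .inl (false, b)) (by
        simp [markedWord, Function.comp_def])
    have h₁ := StackMachine.Run.pop (M := posMachine T q₀ start) (Y := Y) (k := input)
      (l := next) (S := contents ((a :: v).map fun b => .inl (false, b))
        (u.reverse.map fun b => .inl (false, b)) [] []) rfl rfl (by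
          simpa [pushAll, contents] using hS₁)
    rw [hw] at h₁
    have hle : (k - start a : ℕ) * (2 * (N + 1) + C * (N + 1) + 2) ≤
        k * (2 * (N + 1) + C * (N + 1) + 2) := Nat.mul_le_mul_right _ (by omega)
    simp only [List.length_cons] at hN
    have hiff : (∀ v₁ b v₂, a :: v = v₁ ++ b :: v₂ → ∃ m, start b ≤ m ∧ m ≠ Fin.last k ∧
        T.run (q₀ m) (markedWord (u ++ v₁) b v₂) ∈ Y) ↔
        (∃ m, start a ≤ m ∧ m ≠ Fin.last k ∧ T.run (q₀ m) (markedWord u a v) ∈ Y) ∧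
        ∀ v₁ b v₂, v = v₁ ++ b :: v₂ → ∃ m, start b ≤ m ∧ m ≠ Fin.last k ∧
          T.run (q₀ m) (markedWord ((u ++ [a]) ++ v₁) b v₂) ∈ Y := by
      constructor
      · intro h
        refine ⟨by simpa using h [] a v rfl, fun v₁ b v₂ hv => ?_⟩
        simpa using h (a :: v₁) b v₂ (by simp [hv])
      · rintro ⟨h₁, h₂⟩ (_ | ⟨c, v₁⟩) b v₂ hv
        · obtain ⟨rfl, rfl⟩ := List.cons.inj hv
          simpa using h₁
        · obtain ⟨rfl, rfl⟩ := List.cons.inj hv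
          simpa using h₂ v₁ b v₂ rfl
    simp only [hiff]
    by_cases h : ∃ m, start a ≤ m ∧ m ≠ Fin.last k ∧ T.run (q₀ m) (markedWord u a v) ∈ Y
    · obtain ⟨S, hS⟩ := ih (u ++ [a]) (by simpa [add_assoc, add_comm, add_left_comm] using hN)
      refine ⟨S, ?_⟩
      rw [if_pos h] at h₁
      have h₂ := run_back (T := T) (q₀ := q₀) (start := start) (Y := Y) a v []
        (u.reverse.map fun b => .inl (false, b))
      have hback : (markedWord u a v).reverse.map (.inl : _ → (Bool × Γ₁) ⊕ Γ₂) =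
          v.reverse.map (fun b => .inl (false, b)) ++ .inl (true, a) ::
            u.reverse.map fun b => .inl (false, b) := by
        simp [markedWord, Function.comp_def]
      rw [← List.map_reverse, hback] at h₁
      have h₃ := h₁.trans h₂
      simp only [h, true_and]
      simp only [List.reverse_append, List.reverse_singleton, List.singleton_append,
        List.map_cons] at hS
      rw [List.append_nil] at h₃
      refine (h₃.trans hS).mono ?_
      simp only [List.length_cons, add_mul, one_mul]
      omega
    · refine ⟨S₁, ?_⟩
      rw [if_neg h] at h₁
      simp only [h, false_and, if_false]
      refine h₁.mono ?_
      simp only [List.length_cons, add_mul, one_mul]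
      omega

end PositionMachine

/-- A criterion for polynomial-time Turing reducibility: the yes-instances of `X` are recognized by
queries about all outputs of finitely many finite state transducers, on the input with one
position marked. -/
theorem polyTimeReducible_of_transducer {X Y : DecisionProblem.{u}} [Finite X.Letter]
    [Finite Y.Letter] (T : Transducer (Bool × X.Letter) Y.Letter) {k : ℕ}
    (q₀ : Fin (k + 1) → T.Q) (start : X.Letter → Fin (k + 1))
    (h : ∀ x, X.Yes x ↔ ∀ u a v, X.encode x = u ++ a :: v →
      ∃ m, start a ≤ m ∧ m ≠ Fin.last k ∧ T.run (q₀ m) (markedWord u a v) ∈ Y.language) :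
    PolyTimeReducible X Y := by
  classical
  obtain ⟨C, hC⟩ := T.exists_length_run_le
  let p : Polynomial ℕ := .X * (2 * .X + 3 + .C k * (2 * (.X + 1) + .C C * (.X + 1) + 2)) + 1
  refine (posMachine T q₀ start).polyTimeReducible p fun x => ?_
  obtain ⟨S, hS⟩ := run_next (q₀ := q₀) (start := start) (Y := Y.language) hC
    (X.encode x).length (X.encode x) [] (by simp)
  have hinit : Function.update (fun _ => [])
      (posMachine T q₀ start).inputStack ((X.encode x).map (posMachine T q₀ start).inLetter) =
      contents ((X.encode x).map fun b => .inl (false, b)) [] [] [] := by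
    ext1 j; cases j <;> rfl
  have hp : p.eval (X.encode x).length = (X.encode x).length * (2 * (X.encode x).length + 3 +
      k * (2 * ((X.encode x).length + 1) + C * ((X.encode x).length + 1) + 2)) + 1 := by
    simp [p]
  simp only [List.nil_append, ← h] at hS
  rw [hinit, hp]
  refine ⟨_, decide (X.Yes x), hS, ?_, by simp⟩
  by_cases hx : X.Yes x <;> simp [hx, posInstr]

end CspEq

namespace CspEq

open FirstOrder FirstOrder.Language

universe u v w

/-! ### Atomic formulas with disequality -/

section AtomLemmas

variable {L : FirstOrder.Language.{u, v}} {α β : Type*}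

/-- Renaming the variables of an atomic formula. -/
def Atom.relabel (f : α → β) : Atom L α → Atom L β
  | .eq s t => .eq (s.relabel f) (t.relabel f)
  | .rel R ts => .rel R fun i => (ts i).relabel f

lemma Atom.holds_relabel {A : Type*} [L.Structure A] (f : α → β) (φ : Atom L α) (x : β → A) :
    (φ.relabel f).Holds x ↔ φ.Holds (x ∘ f) := by
  cases φ <;> simp [Atom.relabel, Atom.Holds]

lemma Atom.holds_eq {A : Type*} [L.Structure A] (s t : L.Term α) (x : α → A) :
    (Atom.eq s t).Holds x ↔ s.realize x = t.realize x := Iff.rfl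

/-- Terms over the signature with `≠` contain symbols of `L` only. -/
def baseTerm : (L.sum neqLanguage).Term α → L.Term α
  | .var x => .var x
  | .func (.inl f) ts => .func f fun i => baseTerm (ts i)
  | .func (.inr f) _ => Empty.elim f

lemma realize_baseTerm {A : Type*} [L.Structure A] (t : (L.sum neqLanguage).Term α) (x : α → A) :
    (baseTerm t).realize x = t.realize x := by
  induction t with
  | var x => rfl
  | @func l f ts ih =>
    rcases f with f | f
    · simp only [baseTerm, Term.realize, ih]
      rfl
    · exact Empty.elim f

/-- The atomic formula `s ≠ t`. -/
def neqAtom (s t : (L.sum neqLanguage).Term α) : Atom (L.sum neqLanguage) α :=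
  .rel (n := 2) (Sum.inr NeqRel.neq) ![s, t]

lemma holds_neqAtom {A : Type*} [L.Structure A] (s t : (L.sum neqLanguage).Term α) (x : α → A) :
    (neqAtom s t).Holds x ↔ s.realize x ≠ t.realize x := Iff.rfl

/-- Is the atomic formula a disequality? -/
def isNeqAtom : Atom (L.sum neqLanguage) α → Bool
  | .rel (.inr _) _ => true
  | _ => false

lemma exists_eq_neqAtom {φ : Atom (L.sum neqLanguage) α} (h : isNeqAtom φ = true) :
    ∃ s t, φ = neqAtom s t := by
  cases φ with
  | eq s t => cases h
  | @rel n R ts =>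
    rcases R with R | R
    · cases h
    · cases R
      refine ⟨ts 0, ts 1, ?_⟩
      simp only [neqAtom]
      congr 1
      ext1 i
      fin_cases i <;> rfl

/-- Atomic formulas over the signature with `≠` as first-order formulas. -/
def atomFormula : Atom (L.sum neqLanguage) α → L.Formula α
  | .eq s t => (baseTerm s).equal (baseTerm t)
  | .rel (.inl R) ts => R.formula fun i => baseTerm (ts i)
  | .rel (.inr .neq) ts => ((baseTerm (ts 0)).equal (baseTerm (ts 1))).not

lemma realize_atomFormula {A : Type*} [L.Structure A] (φ : Atom (L.sum neqLanguage) α)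
    (x : α → A) : (atomFormula φ).Realize x ↔ φ.Holds x := by
  cases φ with
  | eq s t => simp [atomFormula, Atom.Holds, Formula.realize_equal, realize_baseTerm]
  | @rel n R ts =>
    rcases R with R | R
    · simp [atomFormula, Atom.Holds, Formula.realize_rel, realize_baseTerm]
    · cases R
      simp only [atomFormula, Formula.realize_not, Formula.realize_equal, realize_baseTerm]
      rfl

end AtomLemmas

/-! ### Maximal isolated types and the choice of the constants -/

section Sat

variable {L : FirstOrder.Language.{u, v}} {A : Type w} [L.Structure A] {ι κ : Type}

/-- `Sat Ψ b` says that the tuple `b` satisfies the formula that is obtained from the conjunction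
`Ψ` by existential quantification over the variables from `Var`. -/
def Sat (Ψ : List (Atom (L.sum neqLanguage) (ι ⊕ Var))) (b : ι → A) : Prop :=
  ∃ x : Var → A, ∀ φ ∈ Ψ, φ.Holds (Sum.elim b x)

/-- Satisfaction of `Ψ` by a tuple is a first-order property, as only finitely many variables of `Ψ`
occur. -/
lemma Sat.congr [Nonempty A] {b c : ι → A} (h : ∀ φ : L.Formula ι, φ.Realize b ↔ φ.Realize c)
    (Ψ : List (Atom (L.sum neqLanguage) (ι ⊕ Var))) : Sat Ψ b ↔ Sat Ψ c := by
  obtain ⟨χ, hχ⟩ := exists_formula_realize_iff_exists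
    (List.foldr (· ⊓ ·) ⊤ (Ψ.map atomFormula) : L.Formula (ι ⊕ Var)) A
  have key : ∀ b : ι → A, χ.Realize b ↔ Sat Ψ b := by
    intro b
    rw [hχ]
    refine exists_congr fun x => ?_
    simp only [Formula.Realize, BoundedFormula.realize_foldr_inf]
    simp only [List.mem_map, forall_exists_index, and_imp, forall_apply_eq_imp_iff₂]
    exact forall₂_congr fun φ _ => realize_atomFormula φ _
  rw [← key, ← key, h]

lemma sat_relabel (f : ι → κ) (Ψ : List (Atom (L.sum neqLanguage) (ι ⊕ Var))) (b : κ → A) :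
    Sat (Ψ.map (Atom.relabel (Sum.map f id))) b ↔ Sat Ψ (b ∘ f) := by
  simp [Sat, Atom.holds_relabel, Sum.elim_comp_map]

/-- Conjunction of existentially quantified conjunctions. -/
def merge (Ψ Ψ' : List (Atom (L.sum neqLanguage) (ι ⊕ Var))) :
    List (Atom (L.sum neqLanguage) (ι ⊕ Var)) :=
  Ψ.map (Atom.relabel (Sum.map id (List.cons false))) ++
    Ψ'.map (Atom.relabel (Sum.map id (List.cons true)))

/-- The prefixes `false` and `true` keep the quantified variables of the two conjunctions apart, so
two witnessing assignments can be glued. -/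
lemma sat_merge (Ψ Ψ' : List (Atom (L.sum neqLanguage) (ι ⊕ Var))) (b : ι → A) :
    Sat (merge Ψ Ψ') b ↔ Sat Ψ b ∧ Sat Ψ' b := by
  simp only [Sat, merge, List.mem_append, List.mem_map, or_imp, forall_and, forall_exists_index,
    and_imp, forall_apply_eq_imp_iff₂, Atom.holds_relabel, Sum.elim_comp_map, Function.comp_id]
  constructor
  · rintro ⟨x, h₁, h₂⟩
    exact ⟨⟨_, h₁⟩, ⟨_, h₂⟩⟩
  · rintro ⟨⟨x, h₁⟩, ⟨y, h₂⟩⟩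
    exact ⟨fun
      | [] => x []
      | false :: z => x z
      | true :: z => y z, h₁, h₂⟩

/-- If finitely many tuples represent all types, then every tuple `t` is dominated by a tuple `a`
that satisfies a maximal set of existentially quantified conjunctions, and this set is isolated. -/
lemma exists_maximal_tuple [Nonempty A] {S : Set (ι → A)} (hS : S.Finite)
    (hrep : ∀ x : ι → A, ∃ y ∈ S, ∀ Ψ : List (Atom (L.sum neqLanguage) (ι ⊕ Var)), Sat Ψ x ↔ Sat Ψ y)
    (t : ι → A) :
    ∃ a : ι → A, (∀ Ψ : List (Atom (L.sum neqLanguage) (ι ⊕ Var)), Sat Ψ t → Sat Ψ a) ∧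
      ∃ Ψ₀ : List (Atom (L.sum neqLanguage) (ι ⊕ Var)), Sat Ψ₀ a ∧
        ∀ b : ι → A, Sat Ψ₀ b → ∀ Ψ : List (Atom (L.sum neqLanguage) (ι ⊕ Var)),
          Sat Ψ b → Sat Ψ a := by
  let tp : (ι → A) → Set (List (Atom (L.sum neqLanguage) (ι ⊕ Var))) := fun b => {Ψ | Sat Ψ b}
  have hrange : (Set.range tp).Finite := by
    refine (hS.image tp).subset ?_
    rintro _ ⟨x, rfl⟩
    obtain ⟨y, hy, h⟩ := hrep x
    exact ⟨y, hy, Set.ext fun Ψ => (h Ψ).symm⟩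
  obtain ⟨_, hle, ⟨a, rfl⟩, hmax⟩ := hrange.exists_le_maximal ⟨t, rfl⟩
  refine ⟨a, fun Ψ h => hle h, ?_⟩
  -- For each of the finitely many representatives `b` that fails some member of the set of `a`, one
  -- such member is added to `Ψ₀`.
  have hiso : ∃ Ψ₀ : List (Atom (L.sum neqLanguage) (ι ⊕ Var)), Sat Ψ₀ a ∧
      ∀ b ∈ S, Sat Ψ₀ b → tp a ≤ tp b := by
    clear hrep
    induction S, hS using Set.Finite.induction_on with
    | empty => exact ⟨[], ⟨fun _ => Classical.ofNonempty, by simp⟩, by simp⟩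
    | @insert b S _ _ ih =>
      obtain ⟨Ψ₀, ha, h⟩ := ih
      by_cases hb : tp a ≤ tp b
      · refine ⟨Ψ₀, ha, ?_⟩
        rintro c (rfl | hc) hΨ
        · exact hb
        · exact h c hc hΨ
      · obtain ⟨Ψ₁, h₁, h₂⟩ := Set.not_subset.1 hb
        refine ⟨merge Ψ₀ Ψ₁, (sat_merge _ _ _).2 ⟨ha, h₁⟩, ?_⟩
        rintro c (rfl | hc) hΨ
        · exact absurd ((sat_merge _ _ _).1 hΨ).2 h₂
        · exact h c hc ((sat_merge _ _ _).1 hΨ).1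
  obtain ⟨Ψ₀, ha, h⟩ := hiso
  refine ⟨Ψ₀, ha, fun b hb Ψ hΨ => ?_⟩
  obtain ⟨c, hc, hbc⟩ := hrep b
  -- Isolation yields that the set of `a` is contained in that of `c`; maximality turns this into
  -- the reverse inclusion.
  exact hmax ⟨c, rfl⟩ (h c hc ((hbc _).1 hb)) ((hbc _).1 hΨ)

/-- The constants that are used in the reductions: the pairs `(a (i m), a (j m))` can replace all
pairs of distinct elements, and the type of `a` is maximal and isolated. -/
lemma exists_constants [Countable L.Symbols] [Nonempty A] (hcat : OmegaCategorical L A) :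
    ∃ (n : ℕ) (a : Fin n → A) (k : ℕ) (i j : ℕ → Fin n), 0 < k ∧
      (∀ m, 0 < m → m < k → a (i m) ≠ a (j m)) ∧
      (∀ (Φ : List (Atom (L.sum neqLanguage) Var)) (s t : (L.sum neqLanguage).Term Var) (x : Var → A),
        (∀ φ ∈ Φ, φ.Holds x) → s.realize x ≠ t.realize x →
        ∃ m, 0 < m ∧ m < k ∧ ∃ y : Var → A, (∀ φ ∈ Φ, φ.Holds y) ∧
          s.realize y = a (i m) ∧ t.realize y = a (j m)) ∧
      ∃ Ψ₀ : List (Atom (L.sum neqLanguage) (Fin n ⊕ Var)), Sat Ψ₀ a ∧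
        ∀ b : Fin n → A, Sat Ψ₀ b → ∀ Ψ : List (Atom (L.sum neqLanguage) (Fin n ⊕ Var)),
          Sat Ψ b → Sat Ψ a := by
  obtain ⟨S, hS, hrep⟩ := hcat.exists_finite_types 2
  let l : List (Fin 2 → A) := (hS.subset (Set.sep_subset S fun p => p 0 ≠ p 1)).toFinset.toList
  have hl : ∀ p, p ∈ l ↔ p ∈ S ∧ p 0 ≠ p 1 := by
    intro p
    simp [l]
  -- The listed pairs get the indices from `1` on. Index `0` is a dummy, which ensures that there is
  -- at least one candidate query even if `A` has no two distinct elements.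
  let K := l.length + 1
  let c : ℕ → Fin 2 → A := fun m => l.getD (m - 1) fun _ => Classical.ofNonempty
  let t : Fin (K * 2) → A := fun r => c (finProdFinEquiv.symm r).1 (finProdFinEquiv.symm r).2
  let idx : ℕ → Fin 2 → Fin (K * 2) := fun m e => finProdFinEquiv (Fin.ofNat K m, e)
  have ht : ∀ m < K, t ∘ idx m = c m := by
    intro m hm
    ext e
    simp only [t, idx, Function.comp_apply, Equiv.symm_apply_apply, Fin.ofNat]
    rw [Nat.mod_eq_of_lt hm]
  have hc : ∀ m, 0 < m → m < K → c m ∈ l := by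
    intro m h₁ h₂
    have : m - 1 < l.length := by omega
    simp only [c, List.getD_eq_getElem _ _ this]
    exact List.getElem_mem _
  obtain ⟨S', hS', hrep'⟩ := hcat.exists_finite_types (K * 2)
  obtain ⟨a, hta, hΨ₀⟩ := exists_maximal_tuple (L := L) hS' (fun x => by
    obtain ⟨y, hy, h⟩ := hrep' x
    exact ⟨y, hy, Sat.congr h⟩) t
  refine ⟨K * 2, a, K, fun m => idx m 0, fun m => idx m 1, Nat.succ_pos _, ?_, ?_, hΨ₀⟩
  · intro m h₁ h₂
    have h := hta [neqAtom (.var (.inl (idx m 0))) (.var (.inl (idx m 1)))]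
      ⟨fun _ => Classical.ofNonempty, by
        have := ((hl _).1 (hc m h₁ h₂)).2
        rw [← ht m h₂] at this
        simpa [holds_neqAtom] using this⟩
    obtain ⟨x, hx⟩ := h
    simpa [holds_neqAtom] using hx
  · intro Φ s t' x hΦ hst
    let p : Fin 2 → A := ![s.realize x, t'.realize x]
    let Ψ : List (Atom (L.sum neqLanguage) (Fin 2 ⊕ Var)) :=
      neqAtom (.var (.inl 0)) (.var (.inl 1)) :: .eq (s.relabel Sum.inr) (.var (.inl 0)) ::
        .eq (t'.relabel Sum.inr) (.var (.inl 1)) :: Φ.map (Atom.relabel Sum.inr)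
    have hΨ : ∀ (q : Fin 2 → A), Sat Ψ q ↔ q 0 ≠ q 1 ∧ ∃ y : Var → A, s.realize y = q 0 ∧
        t'.realize y = q 1 ∧ ∀ φ ∈ Φ, φ.Holds y := by
      intro q
      simp [Ψ, Sat, holds_neqAtom, Atom.holds_eq, Atom.holds_relabel]
    obtain ⟨q, hq, hpq⟩ := hrep p
    have hq' := (Sat.congr hpq Ψ).1 ((hΨ p).2 ⟨hst, x, rfl, rfl, hΦ⟩)
    -- The first conjunct of `Ψ` forces the entries of `q` to be distinct, so `q` is on the list.
    obtain ⟨r, hr, hrq⟩ := List.getElem_of_mem ((hl q).2 ⟨hq, ((hΨ q).1 hq').1⟩)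
    have hcr : c (r + 1) = q := by
      simp only [c, Nat.add_sub_cancel, List.getD_eq_getElem _ _ hr, hrq]
    rw [← hcr, ← ht (r + 1) (by omega), ← sat_relabel] at hq'
    have ha := hta _ hq'
    rw [sat_relabel, hΨ] at ha
    obtain ⟨_, y, hy₁, hy₂, hy₃⟩ := ha
    exact ⟨r + 1, Nat.succ_pos _, by omega, y, hy₃, hy₁, hy₂⟩

end Sat

/-! ### Combining solutions along an embedding of the square -/

section Products

variable {L : FirstOrder.Language.{u, v}} {A : Type w} [L.Structure A] {α : Type*}

lemma realize_prod (t : L.Term α) (x y : α → A) :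
    t.realize (fun i => (x i, y i)) = (t.realize x, t.realize y) := by
  induction t with
  | var i => rfl
  | func f ts ih =>
    simp only [Term.realize, ih]
    rfl

lemma realize_embedding_prod (e : L.Embedding (A × A) A) (t : (L.sum neqLanguage).Term α)
    (x y : α → A) : t.realize (fun i => e (x i, y i)) = e (t.realize x, t.realize y) := by
  rw [← realize_baseTerm, ← realize_baseTerm, ← realize_baseTerm, ← realize_prod]
  exact HomClass.realize_term e

/-- The embedding acts as a binary polymorphism of the structure with `≠`: it preserves the
relations, and `≠` by injectivity. -/
lemma holds_embedding_prod (e : L.Embedding (A × A) A) {φ : Atom (L.sum neqLanguage) α}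
    (x y : α → A) (hx : φ.Holds x) (hy : φ.Holds y) : φ.Holds fun i => e (x i, y i) := by
  cases φ with
  | eq s t =>
    simp only [Atom.Holds, realize_embedding_prod] at hx hy ⊢
    rw [hx, hy]
  | @rel n R ts =>
    simp only [Atom.Holds, realize_embedding_prod] at hx hy ⊢
    rcases R with R | R
    · exact (e.map_rel R fun i => ((ts i).realize x, (ts i).realize y)).2 ⟨hx, hy⟩
    · cases R
      intro h
      exact hx (congrArg Prod.fst (e.injective h))

/-- By injectivity of `e`, a difference in one coordinate suffices. This is why disequalities can be
treated separately. -/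
lemma holds_neqAtom_embedding_prod (e : L.Embedding (A × A) A) (s t : (L.sum neqLanguage).Term α)
    (x y : α → A) (h : s.realize x ≠ t.realize x ∨ s.realize y ≠ t.realize y) :
    (neqAtom s t).Holds fun i => e (x i, y i) := by
  rw [holds_neqAtom, realize_embedding_prod, realize_embedding_prod]
  intro heq
  have := Prod.ext_iff.1 (e.injective heq)
  exact h.elim (fun h => h this.1) fun h => h this.2

/-- If `A × A` embeds into `A`, disequalities can be satisfied one by one. -/
lemma exists_holds_of_forall_neqAtom (e : L.Embedding (A × A) A)
    (Φ Θ : List (Atom (L.sum neqLanguage) α)) (hΦ : ∃ x : α → A, ∀ φ ∈ Φ, φ.Holds x)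
    (hΘ : ∀ θ ∈ Θ, isNeqAtom θ = true ∧ ∃ x : α → A, (∀ φ ∈ Φ, φ.Holds x) ∧ θ.Holds x) :
    ∃ x : α → A, (∀ φ ∈ Φ, φ.Holds x) ∧ ∀ θ ∈ Θ, θ.Holds x := by
  induction Θ with
  | nil => simpa using hΦ
  | cons θ Θ ih =>
    obtain ⟨x, hx, hxΘ⟩ := ih fun θ hθ => hΘ θ (List.mem_cons_of_mem _ hθ)
    obtain ⟨hθ, y, hy, hyθ⟩ := hΘ θ List.mem_cons_self
    refine ⟨fun i => e (x i, y i), fun φ hφ => holds_embedding_prod e x y (hx φ hφ) (hy φ hφ), ?_⟩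
    intro θ' hθ'
    rcases List.mem_cons.1 hθ' with rfl | hθ'
    · obtain ⟨s, t, rfl⟩ := exists_eq_neqAtom hθ
      exact holds_neqAtom_embedding_prod e s t x y (Or.inr hyθ)
    · obtain ⟨s, t, rfl⟩ := exists_eq_neqAtom (hΘ θ' (List.mem_cons_of_mem _ hθ')).1
      exact holds_neqAtom_embedding_prod e s t x y (Or.inl (hxΘ _ hθ'))

end Products

end CspEq

namespace CspEq

open FirstOrder FirstOrder.Language

universe u v w

/-! ### Finiteness of the alphabets -/

section Letters

variable {L : FirstOrder.Language.{u, v}}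

lemma finite_symbols_sum {L' : FirstOrder.Language} [Finite L.Symbols] [Finite L'.Symbols] :
    Finite (L.sum L').Symbols := by
  let f : (L.sum L').Symbols → L.Symbols ⊕ L'.Symbols
    | .inl ⟨n, .inl g⟩ => .inl (.inl ⟨n, g⟩)
    | .inl ⟨n, .inr g⟩ => .inr (.inl ⟨n, g⟩)
    | .inr ⟨n, .inl g⟩ => .inl (.inr ⟨n, g⟩)
    | .inr ⟨n, .inr g⟩ => .inr (.inr ⟨n, g⟩)
  refine Finite.of_injective f fun a b h => ?_
  rcases a with ⟨n, a | a⟩ | ⟨n, a | a⟩ <;> rcases b with ⟨m, b | b⟩ | ⟨m, b | b⟩ <;>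
    simp only [f, Sum.inl.injEq, Sum.inr.injEq, Sigma.mk.injEq, reduceCtorEq] at h <;>
    · obtain ⟨rfl, h⟩ := h
      rw [eq_of_heq h]

instance : Finite neqLanguage.Symbols := by
  refine Finite.of_injective (fun _ => ()) ?_
  rintro (⟨_, f⟩ | ⟨_, R⟩) (⟨_, f'⟩ | ⟨_, R'⟩) _
  · exact Empty.elim f
  · exact Empty.elim f
  · exact Empty.elim f'
  · cases R
    cases R'
    rfl

/-- The index of a constant symbol. -/
def constIndex {α : Type*} : ∀ {l : ℕ}, (constantsOn α).Functions l → α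
  | 0, c => c
  | _ + 1, c => PEmpty.elim c

lemma constIndex_inj {α : Type*} {l m : ℕ} {c : (constantsOn α).Functions l}
    {d : (constantsOn α).Functions m} (h : constIndex c = constIndex d) :
    (⟨l, c⟩ : Σ l, (constantsOn α).Functions l) = ⟨m, d⟩ := by
  cases l with
  | succ l => exact PEmpty.elim c
  | zero =>
    cases m with
    | succ m => exact PEmpty.elim d
    | zero => exact congrArg _ h

instance {α : Type*} [Finite α] : Finite (constantsOn α).Symbols := by
  let f : (constantsOn α).Symbols → α
    | .inl ⟨_, c⟩ => constIndex c
    | .inr ⟨_, R⟩ => Empty.elim R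
  refine Finite.of_injective f ?_
  rintro (⟨l, c⟩ | ⟨_, R⟩) (⟨m, d⟩ | ⟨_, R'⟩) h
  · exact congrArg Sum.inl (constIndex_inj h)
  · exact Empty.elim R'
  · exact Empty.elim R
  · exact Empty.elim R

instance [Finite L.Symbols] : Finite (Letter L) := by
  let f : Letter L → L.Symbols ⊕ Fin 7
    | .fn g => .inl (.inl ⟨_, g⟩)
    | .rel g => .inl (.inr ⟨_, g⟩)
    | .eq => .inr 0
    | .var => .inr 1
    | .bit true => .inr 2
    | .bit false => .inr 3
    | .endVar => .inr 4
    | .comma => .inr 5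
    | .semicolon => .inr 6
  refine Finite.of_injective f fun a b h => ?_
  rcases a with a | a | _ | _ | (_ | _) | _ | _ | _ <;>
    rcases b with b | b | _ | _ | (_ | _) | _ | _ | _ <;>
    simp [f] at h ⊢
  · exact h
  · exact h

lemma DecisionProblem.encode_mem_language {X : DecisionProblem.{u}} {x : X.Instance} :
    X.encode x ∈ X.language ↔ X.Yes x := by
  constructor
  · rintro ⟨y, hy, h⟩
    rwa [← X.encode_injective h]
  · exact fun h => ⟨x, h, rfl⟩

end Letters

/-! ### Reduction from constants to disequality -/

section ConstantsToNeq

variable {L : FirstOrder.Language.{u, v}} {n : ℕ}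

/-- Constant symbols become variables. -/
def constToVar : (L.sum (constantsOn (Fin n))).Term Var →
    (L.sum neqLanguage).Term (Fin n ⊕ Var)
  | .var x => .var (.inr x)
  | .func (.inl f) ts => .func (.inl f) fun i => constToVar (ts i)
  | .func (.inr c) _ => .var (.inl (constIndex c))

/-- Constant symbols become variables. -/
def constToVarAtom : Atom (L.sum (constantsOn (Fin n))) Var →
    Atom (L.sum neqLanguage) (Fin n ⊕ Var)
  | .eq s t => .eq (constToVar s) (constToVar t)
  | .rel (.inl R) ts => .rel (.inl R) fun i => constToVar (ts i)
  | .rel (.inr R) _ => Empty.elim R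

lemma realize_constToVar {A : Type w} [L.Structure A] (a : Fin n → A)
    (t : (L.sum (constantsOn (Fin n))).Term Var) (x : Var → A) :
    letI := constantsOn.structure a
    (constToVar t).realize (Sum.elim a x) = t.realize x := by
  let := constantsOn.structure a
  induction t with
  | var x => rfl
  | @func l f ts ih =>
    rcases f with f | c
    · simp only [constToVar, Term.realize, ih]
      rfl
    · cases l with
      | zero => rfl
      | succ l => exact PEmpty.elim c

lemma holds_constToVarAtom {A : Type w} [L.Structure A] (a : Fin n → A)
    (φ : Atom (L.sum (constantsOn (Fin n))) Var) (x : Var → A) :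
    letI := constantsOn.structure a
    (constToVarAtom φ).Holds (Sum.elim a x) ↔ φ.Holds x := by
  let := constantsOn.structure a
  cases φ with
  | eq s t => simp only [constToVarAtom, Atom.Holds, realize_constToVar]
  | @rel l R ts =>
    rcases R with R | R
    · simp only [constToVarAtom, Atom.Holds, realize_constToVar]
      rfl
    · exact Empty.elim R

lemma yes_cspConstants_iff {A : Type w} [L.Structure A] (a : Fin n → A)
    (Φ : List (Atom (L.sum (constantsOn (Fin n))) Var)) :
    (cspConstants L A a).Yes Φ ↔ Sat (Φ.map constToVarAtom) a := by
  simp only [Sat, List.forall_mem_map, holds_constToVarAtom]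
  rfl

/-- The name of a variable or constant in the instances of `CSP(A, ≠)`. -/
def varName : Fin n ⊕ Var → Var
  | .inl i => true :: List.replicate i true
  | .inr x => false :: x

lemma varName_injective : Function.Injective (varName (n := n)) := by
  rintro (i | x) (j | y) h
  · simp only [varName, List.cons.injEq, true_and] at h
    have := congrArg List.length h
    simp only [List.length_replicate] at this
    rw [Fin.ext this]
  · simp [varName] at h
  · simp [varName] at h
  · simp only [varName, List.cons.injEq, true_and] at h
    rw [h]

lemma yes_cspNeq_map_iff {A : Type w} [L.Structure A] [Nonempty A]
    (Ψ : List (Atom (L.sum neqLanguage) (Fin n ⊕ Var))) :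
    (cspNeq L A).Yes (Ψ.map (Atom.relabel varName)) ↔ ∃ b : Fin n → A, Sat Ψ b := by
  change (∃ x : Var → A, ∀ φ ∈ Ψ.map (Atom.relabel varName), φ.Holds x) ↔ _
  simp only [List.forall_mem_map, Atom.holds_relabel, Sat]
  constructor
  · rintro ⟨x, hx⟩
    refine ⟨fun i => x (varName (.inl i)), fun y => x (varName (n := n) (.inr y)), ?_⟩
    convert hx using 4
    ext (_ | _) <;> rfl
  · rintro ⟨b, x, h⟩
    refine ⟨Function.extend varName (Sum.elim b x) fun _ => Classical.ofNonempty, ?_⟩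
    rwa [Function.extend_comp varName_injective]

/-- The translation of letters in the reduction of `CSP(A, a₁, …, aₙ)` to `CSP(A, ≠)`. -/
def letterToNeq : Letter (L.sum (constantsOn (Fin n))) → List (Letter (L.sum neqLanguage))
  | .fn (.inl f) => [.fn (.inl f)]
  | .fn (.inr c) => encodeTerm (.var (varName (.inl (constIndex c))))
  | .rel (.inl R) => [.rel (.inl R)]
  | .rel (.inr R) => Empty.elim R
  | .eq => [.eq]
  -- One `false` comes from `varName`, the other from the left-hand side of `merge`.
  | .var => [.var, .bit false, .bit false]
  | .bit b => [.bit b]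
  | .endVar => [.endVar]
  | .comma => [.comma]
  | .semicolon => [.semicolon]

/-- The renaming of variables in the reduction of `CSP(A, a₁, …, aₙ)` to `CSP(A, ≠)`. -/
def queryName : Fin n ⊕ Var → Var := varName ∘ Sum.map id (List.cons false)

/-- In Polish notation a constant symbol is a complete term, so it may be replaced on the spot by
the encoding of a variable. Hence the translation works letter by letter. -/
lemma encodeTerm_constToVar (t : (L.sum (constantsOn (Fin n))).Term Var) :
    encodeTerm ((constToVar t).relabel queryName) = (encodeTerm t).flatMap letterToNeq := by
  induction t with
  | var x =>
    have : ∀ x : List Bool, (x.map Letter.bit).flatMap (letterToNeq (L := L) (n := n)) =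
        x.map Letter.bit := by
      intro x
      induction x with
      | nil => rfl
      | cons b x ih => simp [letterToNeq, ih]
    simp [constToVar, encodeTerm, queryName, varName, letterToNeq, this]
  | @func l f ts ih =>
    rcases f with f | c
    · simp only [constToVar, Term.relabel, encodeTerm, List.flatMap_cons, List.flatMap_assoc, ih]
      rfl
    · cases l with
      | zero =>
        simp [constToVar, encodeTerm, letterToNeq, queryName]
      | succ l => exact PEmpty.elim c

lemma encodeAtom_constToVar (φ : Atom (L.sum (constantsOn (Fin n))) Var) :
    encodeAtom ((constToVarAtom φ).relabel queryName) = (encodeAtom φ).flatMap letterToNeq := by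
  cases φ with
  | eq s t =>
    simp [constToVarAtom, Atom.relabel, encodeAtom, encodeTerm_constToVar, letterToNeq]
  | @rel l R ts =>
    rcases R with R | R
    · simp only [constToVarAtom, Atom.relabel, encodeAtom, encodeTerm_constToVar,
        List.flatMap_cons, List.flatMap_append, List.flatMap_assoc]
      simp [letterToNeq]
    · exact Empty.elim R

lemma encodeInstance_constToVar (Φ : List (Atom (L.sum (constantsOn (Fin n))) Var)) :
    encodeInstance (Φ.map fun φ => (constToVarAtom φ).relabel queryName) =
      (encodeInstance Φ).flatMap letterToNeq := by
  simp only [encodeInstance, List.flatMap_map, encodeAtom_constToVar, List.flatMap_assoc]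

/-- The transducer that translates letters and appends a word. -/
def homTransducer {Γ₁ Γ₂ : Type u} (h : Γ₁ → List Γ₂) (suffix : List Γ₂) :
    Transducer (Bool × Γ₁) Γ₂ where
  Q := Unit
  δ _ p := ((), h p.2)
  final _ := suffix

lemma run_homTransducer {Γ₁ Γ₂ : Type u} (h : Γ₁ → List Γ₂) (suffix : List Γ₂)
    (w : List (Bool × Γ₁)) :
    (homTransducer h suffix).run () w = (w.map Prod.snd).flatMap h ++ suffix := by
  induction w with
  | nil => rfl
  | cons p w ih =>
    simp only [Transducer.run, List.map_cons, List.flatMap_cons, List.append_assoc, ← ih]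
    rfl

lemma map_snd_markedWord {Γ : Type*} (u : List Γ) (a : Γ) (v : List Γ) :
    (markedWord u a v).map Prod.snd = u ++ a :: v := by
  simp [markedWord, Function.comp_def]

/-- If the type of `a` is maximal and isolated, then `CSP(A, a₁, …, aₙ)` reduces to `CSP(A, ≠)`. -/
theorem polyTimeReducible_cspConstants_cspNeq [Finite L.Symbols] {A : Type w} [L.Structure A]
    [Nonempty A] (a : Fin n → A) (Ψ₀ : List (Atom (L.sum neqLanguage) (Fin n ⊕ Var)))
    (ha : Sat Ψ₀ a) (hmax : ∀ b : Fin n → A, Sat Ψ₀ b →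
      ∀ Ψ : List (Atom (L.sum neqLanguage) (Fin n ⊕ Var)), Sat Ψ b → Sat Ψ a) :
    PolyTimeReducible (cspConstants L A a) (cspNeq L A) := by
  have : Finite (cspConstants L A a).Letter :=
    have := finite_symbols_sum (L := L) (L' := constantsOn (Fin n))
    inferInstanceAs (Finite (Letter (L.sum (constantsOn (Fin n)))))
  have : Finite (cspNeq L A).Letter :=
    have := finite_symbols_sum (L := L) (L' := neqLanguage)
    inferInstanceAs (Finite (Letter (L.sum neqLanguage)))
  let suffix : List (Letter (L.sum neqLanguage)) := encodeInstance
    (Ψ₀.map (Atom.relabel (varName ∘ Sum.map id (List.cons true))))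
  -- There is a single candidate, and the mark is ignored: every position asks the same query.
  refine polyTimeReducible_of_transducer (X := cspConstants L A a) (Y := cspNeq L A)
    (homTransducer (letterToNeq (L := L) (n := n)) suffix) (k := 1) (fun _ => ()) (fun _ => 0) ?_
  intro (Φ : List (Atom (L.sum (constantsOn (Fin n))) Var))
  have hquery : ∀ u b v, encodeInstance Φ = u ++ b :: v →
      ((homTransducer (letterToNeq (L := L) (n := n)) suffix).run () (markedWord u b v) ∈
        (cspNeq L A).language ↔ (cspConstants L A a).Yes Φ) := by
    intro u b v h
    have hrun : (homTransducer (letterToNeq (L := L) (n := n)) suffix).run () (markedWord u b v) =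
        encodeInstance ((merge (Φ.map constToVarAtom) Ψ₀).map (Atom.relabel varName)) := by
      rw [run_homTransducer, map_snd_markedWord, ← h, ← encodeInstance_constToVar]
      have hrel : ∀ (g : Var → Var) (φ : Atom (L.sum neqLanguage) (Fin n ⊕ Var)),
          (φ.relabel (Sum.map id g)).relabel varName = φ.relabel (varName ∘ Sum.map id g) := by
        intro g φ
        cases φ <;> simp [Atom.relabel]
      simp only [merge, List.map_append, List.map_map, Function.comp_def, hrel, suffix,
        encodeInstance, List.flatMap_append]
      rfl
    rw [hrun, yes_cspConstants_iff]
    refine (DecisionProblem.encode_mem_language (X := cspNeq L A)).trans ?_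
    rw [yes_cspNeq_map_iff]
    simp only [sat_merge]
    -- If any tuple `b` satisfies both parts, isolation transfers the instance from `b` to `a`;
    -- conversely `a` itself can be used.
    exact ⟨fun ⟨b, h₁, h₂⟩ => hmax b h₂ _ h₁, fun h => ⟨a, h, ha⟩⟩
  constructor
  · exact fun h u b v huv => ⟨0, le_rfl, by decide, (hquery u b v huv).2 h⟩
  · intro h
    cases hΦ : encodeInstance Φ with
    | nil =>
      have : Φ = [] := encodeInstance_injective hΦ
      subst this
      rw [yes_cspConstants_iff]
      exact ⟨fun _ => Classical.ofNonempty, by simp⟩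
    | cons b v =>
      obtain ⟨_, _, _, hm⟩ := h [] b v hΦ
      exact (hquery [] b v hΦ).1 hm

end ConstantsToNeq

end CspEq

namespace CspEq

open FirstOrder FirstOrder.Language

universe u v w

/-! ### Reduction from disequality to constants -/

section NeqToConstants

variable {L : FirstOrder.Language.{u, v}} {n : ℕ}

/-- Terms over the signature with `≠` as terms over the signature with constants. -/
def neqToConst : (L.sum neqLanguage).Term Var → (L.sum (constantsOn (Fin n))).Term Var
  | .var x => .var x
  | .func (.inl f) ts => .func (.inl f) fun i => neqToConst (ts i)
  | .func (.inr f) _ => Empty.elim f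

/-- The term denoting the `i`-th constant. -/
def constTerm (i : Fin n) : (L.sum (constantsOn (Fin n))).Term Var :=
  .func (l := 0) (.inr i) Fin.elim0

/-- Atomic formulas other than disequalities are kept, disequalities are dropped. -/
def positivePart : Atom (L.sum neqLanguage) Var → List (Atom (L.sum (constantsOn (Fin n))) Var)
  | .eq s t => [.eq (neqToConst s) (neqToConst t)]
  | .rel (.inl R) ts => [.rel (.inl R) fun i => neqToConst (ts i)]
  | .rel (.inr _) _ => []

/-- The values of `s` and `t` are prescribed. -/
def prescribe (i j : Fin n) (s t : (L.sum neqLanguage).Term Var) :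
    List (Atom (L.sum (constantsOn (Fin n))) Var) :=
  [.eq (neqToConst s) (constTerm i), .eq (neqToConst t) (constTerm j)]

section Semantics

variable {A : Type w} [L.Structure A] (a : Fin n → A)

lemma realize_neqToConst (t : (L.sum neqLanguage).Term Var) (x : Var → A) :
    letI := constantsOn.structure a
    (neqToConst (n := n) t).realize x = t.realize x := by
  let := constantsOn.structure a
  induction t with
  | var x => rfl
  | @func l f ts ih =>
    rcases f with f | f
    · simp only [neqToConst, Term.realize, ih]
      rfl
    · exact Empty.elim f

lemma holds_positivePart (φ : Atom (L.sum neqLanguage) Var) (x : Var → A) :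
    letI := constantsOn.structure a
    (∀ ψ ∈ positivePart (n := n) φ, ψ.Holds x) ↔ (isNeqAtom φ = false → φ.Holds x) := by
  let := constantsOn.structure a
  cases φ with
  | eq s t => simp [positivePart, Atom.holds_eq, realize_neqToConst, isNeqAtom]
  | @rel l R ts =>
    rcases R with R | R
    · simp only [positivePart, List.mem_singleton, forall_eq, isNeqAtom, forall_const, Atom.Holds,
        realize_neqToConst]
      rfl
    · simp [positivePart, isNeqAtom]

lemma holds_prescribe (i j : Fin n) (s t : (L.sum neqLanguage).Term Var) (x : Var → A) :
    letI := constantsOn.structure a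
    (∀ ψ ∈ prescribe i j s t, ψ.Holds x) ↔ s.realize x = a i ∧ t.realize x = a j := by
  let := constantsOn.structure a
  simp only [prescribe, List.mem_cons, List.not_mem_nil, or_false, forall_eq_or_imp, forall_eq,
    Atom.holds_eq, realize_neqToConst]
  rfl

lemma holds_flatMap_positivePart (Φ : List (Atom (L.sum neqLanguage) Var)) (x : Var → A) :
    letI := constantsOn.structure a
    (∀ ψ ∈ Φ.flatMap (positivePart (n := n)), ψ.Holds x) ↔
      ∀ φ ∈ Φ, isNeqAtom φ = false → φ.Holds x := by
  let := constantsOn.structure a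
  simp only [List.forall_mem_flatMap, holds_positivePart]

lemma yes_positivePart_iff (Φ : List (Atom (L.sum neqLanguage) Var)) :
    (cspConstants L A a).Yes (Φ.flatMap positivePart) ↔
      ∃ x : Var → A, ∀ φ ∈ Φ, isNeqAtom φ = false → φ.Holds x :=
  exists_congr fun x => holds_flatMap_positivePart a Φ x

/-- The selected disequality imposes no condition through the positive part; it is replaced by the
two prescribed values. -/
lemma yes_prescribe_iff (Φ₁ Φ₂ : List (Atom (L.sum neqLanguage) Var)) (i j : Fin n)
    (s t : (L.sum neqLanguage).Term Var) :
    (cspConstants L A a).Yes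
      (Φ₁.flatMap positivePart ++ (prescribe i j s t ++ Φ₂.flatMap positivePart)) ↔
      ∃ x : Var → A, (∀ φ ∈ Φ₁ ++ neqAtom s t :: Φ₂, isNeqAtom φ = false → φ.Holds x) ∧
        s.realize x = a i ∧ t.realize x = a j := by
  let := constantsOn.structure a
  refine exists_congr fun x => ?_
  have h : (∀ ψ ∈ Φ₁.flatMap positivePart ++ (prescribe i j s t ++ Φ₂.flatMap positivePart),
      ψ.Holds x) ↔ (∀ ψ ∈ Φ₁.flatMap (positivePart (n := n)), ψ.Holds x) ∧
        (∀ ψ ∈ prescribe i j s t, ψ.Holds x) ∧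
        ∀ ψ ∈ Φ₂.flatMap (positivePart (n := n)), ψ.Holds x := by
    simp only [List.forall_mem_append]
  refine h.trans ?_
  rw [holds_flatMap_positivePart, holds_flatMap_positivePart, holds_prescribe]
  have hneq : isNeqAtom (neqAtom s t) = true := rfl
  simp only [List.forall_mem_append, List.forall_mem_cons, hneq]
  tauto

end Semantics

/-- The letters that open a disequality. -/
def isNeqLetter : Letter (L.sum neqLanguage) → Bool
  | .rel (.inr _) => true
  | _ => false

/-- The translation of letters in the reduction of `CSP(A, ≠)` to `CSP(A, a₁, …, aₙ)`. -/
def letterToConst : Letter (L.sum neqLanguage) → Letter (L.sum (constantsOn (Fin n)))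
  | .fn (.inl f) => .fn (.inl f)
  | .fn (.inr f) => Empty.elim f
  | .rel (.inl R) => .rel (.inl R)
  | .rel (.inr _) => .eq
  | .eq => .eq
  | .var => .var
  | .bit b => .bit b
  | .endVar => .endVar
  | .comma => .comma
  | .semicolon => .semicolon

/-- The letters that occur in terms. -/
def isTermLetter : Letter (L.sum neqLanguage) → Bool
  | .fn _ => true
  | .var => true
  | .bit _ => true
  | .endVar => true
  | _ => false

lemma encodeTerm_neqToConst (t : (L.sum neqLanguage).Term Var) :
    encodeTerm (neqToConst (n := n) t) = (encodeTerm t).map letterToConst := by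
  induction t with
  | var x => simp [neqToConst, encodeTerm, letterToConst, Function.comp_def]
  | @func l f ts ih =>
    rcases f with f | f
    · simp only [neqToConst, encodeTerm, List.map_cons, List.map_flatMap, ih]
      rfl
    · exact Empty.elim f

lemma isTermLetter_of_mem_encodeTerm (t : (L.sum neqLanguage).Term Var) :
    ∀ l ∈ encodeTerm t, isTermLetter l = true := by
  induction t with
  | var x =>
    simp only [encodeTerm, List.mem_cons, List.mem_append, List.mem_map, List.not_mem_nil, or_false]
    rintro _ (rfl | ⟨b, _, rfl⟩ | rfl) <;> rfl
  | @func l f ts ih =>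
    simp only [encodeTerm, List.mem_cons, List.mem_flatMap]
    rintro _ (rfl | ⟨i, _, h⟩)
    · rfl
    · exact ih i _ h

/-- The modes of the transducer in the reduction of `CSP(A, ≠)` to `CSP(A, a₁, …, aₙ)`: copying,
skipping a disequality, and inside the first and second argument of the marked disequality. -/
inductive Mode
  | copy | skip | first | second

open Mode

instance : Finite Mode := by
  let f : Mode → Fin 4
    | copy => 0
    | skip => 1
    | first => 2
    | second => 3
  refine Finite.of_injective f fun a b h => ?_
  cases a <;> cases b <;> simp_all [f]

/-- The letter that denotes the `i`-th constant. -/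
def constLetter (i : Fin n) : Letter (L.sum (constantsOn (Fin n))) := .fn (n := 0) (.inr i)

/-- One step of the transducer in the reduction of `CSP(A, ≠)` to `CSP(A, a₁, …, aₙ)`. -/
def neqStep (i j : Fin n) : Mode → Bool × Letter (L.sum neqLanguage) →
    Mode × List (Letter (L.sum (constantsOn (Fin n))))
  | copy, (true, .rel (.inr _)) => (first, [.eq])
  | copy, (false, .rel (.inr _)) => (skip, [])
  | copy, (_, l) => (copy, [letterToConst l])
  | skip, (_, .semicolon) => (copy, [])
  | skip, _ => (skip, [])
  -- Closes the equation of the first argument with constant `i` and opens the one of the second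
  -- argument. The semicolon of the disequality itself is later copied and closes the latter.
  | first, (_, .comma) => (second, [.comma, constLetter i, .comma, .semicolon, .eq])
  | first, (_, l) => (first, [letterToConst l])
  | second, (_, .comma) => (copy, [.comma, constLetter j, .comma])
  | second, (_, l) => (second, [letterToConst l])

/-- The transducer in the reduction of `CSP(A, ≠)` to `CSP(A, a₁, …, aₙ)`. -/
def neqTransducer (L : FirstOrder.Language.{u, v}) {k : ℕ} (i j : ℕ → Fin n) :
    Transducer (Bool × Letter (L.sum neqLanguage)) (Letter (L.sum (constantsOn (Fin n)))) where
  Q := Mode × Fin (k + 1)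
  δ q p := (((neqStep (i q.2) (j q.2) q.1 p).1, q.2), (neqStep (i q.2) (j q.2) q.1 p).2)
  final _ := []

variable {k : ℕ} (i j : ℕ → Fin n) (m : Fin (k + 1))

/-- The output of the transducer for the disequality `m`. -/
abbrev neqRun (md : Mode) (w : List (Bool × Letter (L.sum neqLanguage))) :
    List (Letter (L.sum (constantsOn (Fin n)))) :=
  (neqTransducer L (k := k) i j).run (md, m) w

lemma neqRun_cons (md : Mode) (p : Bool × Letter (L.sum neqLanguage))
    (w : List (Bool × Letter (L.sum neqLanguage))) :
    neqRun i j m md (p :: w) =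
      (neqStep (i m) (j m) md p).2 ++ neqRun i j m (neqStep (i m) (j m) md p).1 w := rfl

lemma neqStep_of_isTermLetter (i j : Fin n) {md : Mode} (hmd : md ≠ skip)
    {p : Bool × Letter (L.sum neqLanguage)} (hp : isTermLetter p.2 = true) :
    neqStep i j md p = (md, [letterToConst p.2]) := by
  obtain ⟨_ | _, l⟩ := p <;> cases md <;> cases l <;>
    first | rfl | exact absurd rfl hmd | exact absurd hp Bool.false_ne_true

lemma neqStep_copy (i j : Fin n) {p : Bool × Letter (L.sum neqLanguage)}
    (hp : isNeqLetter p.2 = false) : neqStep i j copy p = (copy, [letterToConst p.2]) := by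
  obtain ⟨_ | _, l⟩ := p <;> rcases l with _ | (_ | _) | _ | _ | _ | _ | _ | _ <;>
    first | rfl | exact absurd hp Bool.noConfusion

lemma neqRun_of_forall {md : Mode}
    (w w' : List (Bool × Letter (L.sum neqLanguage)))
    (hw : ∀ p ∈ w, neqStep (i m) (j m) md p = (md, [letterToConst p.2])) :
    neqRun i j m md (w ++ w') =
      (w.map Prod.snd).map letterToConst ++ neqRun i j m md w' := by
  induction w with
  | nil => rfl
  | cons p w ih =>
    rw [List.cons_append, neqRun_cons, hw p (by simp),
      ih fun q hq => hw q (List.mem_cons_of_mem _ hq)]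
    rfl

lemma neqRun_term {md : Mode} (hmd : md ≠ skip) (t : (L.sum neqLanguage).Term Var)
    (w w' : List (Bool × Letter (L.sum neqLanguage))) (hw : w.map Prod.snd = encodeTerm t) :
    neqRun i j m md (w ++ w') = encodeTerm (neqToConst t) ++ neqRun i j m md w' := by
  rw [encodeTerm_neqToConst, ← hw]
  refine neqRun_of_forall i j m w w' fun p hp => neqStep_of_isTermLetter _ _ hmd ?_
  exact isTermLetter_of_mem_encodeTerm t _ (hw ▸ List.mem_map_of_mem hp)

lemma neqRun_skip (w w' : List (Bool × Letter (L.sum neqLanguage)))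
    (hw : ∀ p ∈ w, p.2 ≠ .semicolon) :
    neqRun i j m skip (w ++ w') = neqRun i j m skip w' := by
  induction w with
  | nil => rfl
  | cons p w ih =>
    have hp : neqStep (i m) (j m) skip p = (skip, []) := by
      have := hw p (by simp)
      obtain ⟨b, l⟩ := p
      cases l <;> first | rfl | exact absurd rfl this
    rw [List.cons_append, neqRun_cons, hp, ih fun q hq => hw q (List.mem_cons_of_mem _ hq)]
    rfl

lemma isNeqLetter_of_isTermLetter {l : Letter (L.sum neqLanguage)} (h : isTermLetter l = true) :
    isNeqLetter l = false := by
  cases l <;> first | rfl | exact absurd h Bool.false_ne_true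

/-- The encoding of a disequality without its first letter. -/
def neqTail (s t : (L.sum neqLanguage).Term Var) : List (Letter (L.sum neqLanguage)) :=
  encodeTerm s ++ .comma :: (encodeTerm t ++ [.comma, .semicolon])

lemma encodeAtom_neqAtom (s t : (L.sum neqLanguage).Term Var) :
    encodeAtom (neqAtom s t) = .rel (n := 2) (.inr NeqRel.neq) :: neqTail s t := by
  simp [encodeAtom, neqAtom, neqTail, List.finRange_succ]

/-- The letter `≠` occurs only at the beginning of an atom, so its positions correspond to the
disequalities of the instance. -/
lemma encodeAtom_eq_cons (φ : Atom (L.sum neqLanguage) Var) :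
    ∃ l w, encodeAtom φ = l :: w ∧ isNeqLetter l = isNeqAtom φ ∧
      ∀ l ∈ w, isNeqLetter l = false := by
  have hterm : ∀ t : (L.sum neqLanguage).Term Var, ∀ l ∈ encodeTerm t, isNeqLetter l = false :=
    fun t l hl => isNeqLetter_of_isTermLetter (isTermLetter_of_mem_encodeTerm t l hl)
  cases φ with
  | eq s t =>
    refine ⟨_, _, rfl, rfl, fun l hl => ?_⟩
    simp only [List.mem_append, List.mem_cons, List.not_mem_nil, or_false] at hl
    rcases hl with hl | rfl | hl | rfl | rfl
    exacts [hterm _ _ hl, rfl, hterm _ _ hl, rfl, rfl]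
  | @rel k R ts =>
    refine ⟨_, _, rfl, by cases R <;> rfl, fun l hl => ?_⟩
    simp only [List.mem_append, List.mem_flatMap, List.mem_cons, List.not_mem_nil, or_false] at hl
    rcases hl with ⟨i, _, hl | rfl⟩ | rfl
    exacts [hterm _ _ hl, rfl, rfl]

lemma encodeInstance_positivePart {φ : Atom (L.sum neqLanguage) Var} (hφ : isNeqAtom φ = false) :
    encodeInstance (positivePart (n := n) φ) = (encodeAtom φ).map letterToConst := by
  cases φ with
  | eq s t =>
    simp [encodeInstance, positivePart, encodeAtom, encodeTerm_neqToConst, letterToConst]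
  | @rel l R ts =>
    rcases R with R | R
    · simp only [encodeInstance, positivePart, encodeAtom, encodeTerm_neqToConst,
        List.flatMap_cons, List.flatMap_nil, List.append_nil, List.map_cons, List.map_append,
        List.map_flatMap]
      simp [letterToConst]
    · cases hφ

/-- An unmarked disequality is skipped up to the next semicolon, which is its own because terms
contain none. In all other atoms the transducer ignores marks and translates each letter. -/
lemma neqRun_atom (φ : Atom (L.sum neqLanguage) Var)
    (w w' : List (Bool × Letter (L.sum neqLanguage))) (hw : w.map Prod.snd = encodeAtom φ)
    (hmark : ∀ p ∈ w, p.1 = true → isNeqLetter p.2 = false) :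
    neqRun i j m copy (w ++ w') =
      encodeInstance (positivePart φ) ++ neqRun i j m copy w' := by
  cases hφ : isNeqAtom φ with
  | false =>
    rw [encodeInstance_positivePart hφ, ← hw]
    refine neqRun_of_forall i j m w w' fun p hp => neqStep_copy _ _ ?_
    obtain ⟨l, v, hlv, hl, hv⟩ := encodeAtom_eq_cons φ
    have : p.2 ∈ encodeAtom φ := hw ▸ List.mem_map_of_mem hp
    rw [hlv] at this
    rcases List.mem_cons.1 this with h | h
    · rw [h, hl, hφ]
    · exact hv _ h
  | true =>
    obtain ⟨s, t, rfl⟩ := exists_eq_neqAtom hφ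
    rw [encodeAtom_neqAtom] at hw
    obtain ⟨⟨b, l⟩, v, rfl, rfl : l = _, hv⟩ := List.map_eq_cons_iff.1 hw
    have hb : b = false := by
      cases b with
      | false => rfl
      | true => cases (hmark _ List.mem_cons_self rfl :)
    subst hb
    have hsplit : neqTail s t = (encodeTerm s ++ .comma :: (encodeTerm t ++ [.comma])) ++
        [.semicolon] := by simp [neqTail]
    rw [hsplit] at hv
    obtain ⟨w₁, w₂, rfl, hw₁, hw₂⟩ := List.map_eq_append_iff.1 hv
    obtain ⟨⟨b, l⟩, w₃, rfl, rfl : l = _, hw₃⟩ := List.map_eq_cons_iff.1 hw₂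
    obtain rfl : w₃ = [] := List.map_eq_nil_iff.1 hw₃
    rw [List.cons_append, neqRun_cons, List.append_assoc]
    change neqRun i j m skip _ = _
    rw [neqRun_skip _ _ _ _ _ fun p hp h => ?_]
    · rfl
    · have : Letter.semicolon ∈ encodeTerm s ++ .comma :: (encodeTerm t ++ [.comma]) := by
        rw [← hw₁, ← h]
        exact List.mem_map_of_mem hp
      simp only [List.mem_append, List.mem_cons, List.not_mem_nil, or_false, reduceCtorEq,
        false_or] at this
      rcases this with h | h <;> cases isTermLetter_of_mem_encodeTerm _ _ h

lemma neqRun_instance (Φ : List (Atom (L.sum neqLanguage) Var))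
    (w w' : List (Bool × Letter (L.sum neqLanguage))) (hw : w.map Prod.snd = encodeInstance Φ)
    (hmark : ∀ p ∈ w, p.1 = true → isNeqLetter p.2 = false) :
    neqRun i j m copy (w ++ w') =
      encodeInstance (Φ.flatMap positivePart) ++ neqRun i j m copy w' := by
  induction Φ generalizing w with
  | nil =>
    obtain rfl : w = [] := List.map_eq_nil_iff.1 hw
    rfl
  | cons φ Φ ih =>
    obtain ⟨w₁, w₂, rfl, hw₁, hw₂⟩ := List.map_eq_append_iff.1 hw
    rw [List.append_assoc, neqRun_atom i j m φ _ _ hw₁ fun p hp => hmark p (by simp [hp]),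
      ih _ hw₂ fun p hp => hmark p (by simp [hp])]
    simp [encodeInstance]

lemma neqRun_marked (s t : (L.sum neqLanguage).Term Var)
    (w : List (Bool × Letter (L.sum neqLanguage))) :
    neqRun i j m copy ((true, .rel (n := 2) (.inr NeqRel.neq)) ::
      ((neqTail s t).map (Prod.mk false) ++ w)) =
      encodeInstance (prescribe (i m) (j m) s t) ++ neqRun i j m copy w := by
  have hterm : ∀ t : (L.sum neqLanguage).Term Var,
      ((encodeTerm t).map (Prod.mk false)).map Prod.snd = encodeTerm t := fun t => by
    simp [Function.comp_def]
  rw [neqRun_cons]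
  change [.eq] ++ neqRun i j m first _ = _
  simp only [neqTail, List.map_append, List.map_cons, List.append_assoc, List.cons_append]
  rw [neqRun_term i j m (by simp) s _ _ (hterm s), neqRun_cons]
  change [.eq] ++ (_ ++ ([.comma, constLetter (i m), .comma, .semicolon, .eq] ++
    neqRun i j m second _)) = _
  rw [neqRun_term i j m (by simp) t _ _ (hterm t), neqRun_cons]
  change [.eq] ++ (_ ++ ([.comma, constLetter (i m), .comma, .semicolon, .eq] ++
    (_ ++ ([.comma, constLetter (j m), .comma] ++ neqRun i j m copy _)))) = _
  rw [List.map_nil, List.nil_append, neqRun_cons]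
  change [.eq] ++ (_ ++ ([.comma, constLetter (i m), .comma, .semicolon, .eq] ++
    (_ ++ ([.comma, constLetter (j m), .comma] ++ ([.semicolon] ++ neqRun i j m copy _))))) = _
  simp [encodeInstance, prescribe, encodeAtom, constTerm, encodeTerm, constLetter]

/-- A letter that opens a disequality determines a conjunct of the instance. -/
lemma exists_neqAtom_of_encodeInstance_eq (Φ : List (Atom (L.sum neqLanguage) Var))
    {u v : List (Letter (L.sum neqLanguage))} {l : Letter (L.sum neqLanguage)}
    (hl : isNeqLetter l = true) (h : encodeInstance Φ = u ++ l :: v) :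
    ∃ Φ₁ s t Φ₂, Φ = Φ₁ ++ neqAtom s t :: Φ₂ ∧ u = encodeInstance Φ₁ ∧
      l = .rel (n := 2) (.inr NeqRel.neq) ∧ v = neqTail s t ++ encodeInstance Φ₂ := by
  induction Φ generalizing u with
  | nil => simp [encodeInstance] at h
  | cons φ Φ ih =>
    have h' : encodeAtom φ ++ encodeInstance Φ = u ++ l :: v := h
    rcases List.append_eq_append_iff.1 h' with ⟨u', rfl, hu⟩ | ⟨v', hφ, hv⟩
    · obtain ⟨Φ₁, s, t, Φ₂, rfl, rfl, hl', hv⟩ := ih hu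
      exact ⟨φ :: Φ₁, s, t, Φ₂, rfl, rfl, hl', hv⟩
    · cases v' with
      | nil =>
        obtain ⟨Φ₁, s, t, Φ₂, rfl, hnil, hl', hv'⟩ := ih (u := []) (by simpa using hv.symm)
        refine ⟨φ :: Φ₁, s, t, Φ₂, rfl, ?_, hl', hv'⟩
        rw [List.append_nil] at hφ
        change u = encodeAtom φ ++ encodeInstance Φ₁
        rw [← hnil, hφ, List.append_nil]
      | cons l' v' =>
        obtain ⟨rfl, rfl⟩ := List.cons.inj hv
        obtain ⟨l₀, w, hw, hl₀, hneq⟩ := encodeAtom_eq_cons φ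
        rw [hw] at hφ
        cases u with
        | nil =>
          obtain ⟨rfl, rfl⟩ := List.cons.inj hφ
          rw [hl] at hl₀
          obtain ⟨s, t, rfl⟩ := exists_eq_neqAtom hl₀.symm
          rw [encodeAtom_neqAtom] at hw
          obtain ⟨rfl, rfl⟩ := List.cons.inj hw
          exact ⟨[], s, t, Φ, rfl, rfl, rfl, rfl⟩
        | cons l₁ u =>
          obtain ⟨rfl, rfl⟩ := List.cons.inj hφ
          rw [hneq l (by simp)] at hl
          cases hl

/-- If all pairs of distinct elements can be replaced by the pairs `(a (i m), a (j m))`, and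
`A × A` embeds into `A`, then `CSP(A, ≠)` reduces to `CSP(A, a₁, …, aₙ)`. -/
theorem polyTimeReducible_cspNeq_cspConstants [Finite L.Symbols] {A : Type w} [L.Structure A]
    [Nonempty A] (e : L.Embedding (A × A) A) (a : Fin n → A) {k : ℕ} (i j : ℕ → Fin n)
    (hk : 0 < k) (hij : ∀ m, 0 < m → m < k → a (i m) ≠ a (j m))
    (hpairs : ∀ (Φ : List (Atom (L.sum neqLanguage) Var)) (s t : (L.sum neqLanguage).Term Var)
      (x : Var → A), (∀ φ ∈ Φ, φ.Holds x) → s.realize x ≠ t.realize x →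
        ∃ m, 0 < m ∧ m < k ∧ ∃ y : Var → A, (∀ φ ∈ Φ, φ.Holds y) ∧
          s.realize y = a (i m) ∧ t.realize y = a (j m)) :
    PolyTimeReducible (cspNeq L A) (cspConstants L A a) := by
  have : Finite (cspConstants L A a).Letter :=
    have := finite_symbols_sum (L := L) (L' := constantsOn (Fin n))
    inferInstanceAs (Finite (Letter (L.sum (constantsOn (Fin n)))))
  have : Finite (cspNeq L A).Letter :=
    have := finite_symbols_sum (L := L) (L' := neqLanguage)
    inferInstanceAs (Finite (Letter (L.sum neqLanguage)))
  -- A disequality must try genuine pairs only, so it leaves out the dummy index `0`. At other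
  -- letters all candidates ask about the positive part, and `0` is always available.
  let start : Letter (L.sum neqLanguage) → Fin (k + 1) := fun l =>
    ⟨if isNeqLetter l then 1 else 0, by split <;> omega⟩
  refine polyTimeReducible_of_transducer (X := cspNeq L A) (Y := cspConstants L A a)
    (neqTransducer L (k := k) i j) (k := k) (fun m => (copy, m)) start ?_
  intro (Φ : List (Atom (L.sum neqLanguage) Var))
  have hpos : ∀ (m : Fin (k + 1)) u l v, encodeInstance Φ = u ++ l :: v → isNeqLetter l = false →
      (neqRun i j m copy (markedWord u l v) ∈ (cspConstants L A a).language ↔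
        ∃ x : Var → A, ∀ φ ∈ Φ, isNeqAtom φ = false → φ.Holds x) := by
    intro m u l v h hl
    have hrun : neqRun i j m copy (markedWord u l v) =
        encodeInstance (Φ.flatMap positivePart) := by
      have := neqRun_instance i j m Φ (markedWord u l v) []
        (by rw [map_snd_markedWord, h]) (by
          intro p hp hp1
          simp only [markedWord, List.mem_append, List.mem_map, List.mem_cons] at hp
          rcases hp with ⟨_, _, rfl⟩ | rfl | ⟨_, _, rfl⟩
          · cases hp1
          · exact hl
          · cases hp1)
      rw [List.append_nil] at this
      exact this.trans (List.append_nil _)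
    rw [hrun]
    exact (DecisionProblem.encode_mem_language (X := cspConstants L A a)).trans
      (yes_positivePart_iff a Φ)
  have hneq : ∀ (m : Fin (k + 1)) Φ₁ s t Φ₂, Φ = Φ₁ ++ neqAtom s t :: Φ₂ →
      (neqRun i j m copy (markedWord (encodeInstance Φ₁) (.rel (n := 2) (.inr NeqRel.neq))
        (neqTail s t ++ encodeInstance Φ₂)) ∈ (cspConstants L A a).language ↔
        ∃ x : Var → A, (∀ φ ∈ Φ, isNeqAtom φ = false → φ.Holds x) ∧
          s.realize x = a (i m) ∧ t.realize x = a (j m)) := by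
    rintro m Φ₁ s t Φ₂ rfl
    have hrun : neqRun i j m copy (markedWord (encodeInstance Φ₁)
        (.rel (n := 2) (.inr NeqRel.neq)) (neqTail s t ++ encodeInstance Φ₂)) =
        encodeInstance (Φ₁.flatMap positivePart ++ (prescribe (i m) (j m) s t ++
          Φ₂.flatMap positivePart)) := by
      have hunmark : ∀ w : List (Letter (L.sum neqLanguage)),
          ∀ p ∈ w.map (Prod.mk false), p.1 = true → isNeqLetter p.2 = false := by
        intro w p hp hp1
        obtain ⟨_, _, rfl⟩ := List.mem_map.1 hp
        cases hp1
      have h₂ := neqRun_instance i j m Φ₂ ((encodeInstance Φ₂).map (Prod.mk false)) []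
        (by simp [Function.comp_def]) (hunmark _)
      rw [List.append_nil] at h₂
      rw [markedWord, neqRun_instance i j m Φ₁ _ _ (by simp [Function.comp_def]) (hunmark _),
        List.map_append, neqRun_marked, h₂]
      change _ ++ (_ ++ (_ ++ [])) = _
      simp [encodeInstance]
    rw [hrun]
    exact (DecisionProblem.encode_mem_language (X := cspConstants L A a)).trans
      (yes_prescribe_iff a Φ₁ Φ₂ _ _ s t)
  constructor
  · rintro ⟨x, hx⟩ u l v h
    cases hl : isNeqLetter l with
    | false =>
      exact ⟨start l, le_rfl, fun h => by
        have := congrArg Fin.val h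
        simp [start, hl] at this
        omega, (hpos _ u l v h hl).2 ⟨x, fun φ hφ _ => hx φ hφ⟩⟩
    | true =>
      obtain ⟨Φ₁, s, t, Φ₂, hΦ, rfl, rfl, rfl⟩ := exists_neqAtom_of_encodeInstance_eq Φ hl h
      -- Only the positive atoms need to survive the replacement of the values of `s` and `t`, since
      -- the query drops the other disequalities.
      obtain ⟨m, hm, hmk, y, hy, hs, ht⟩ := hpairs (Φ.filter fun φ => isNeqAtom φ = false) s t x
        (fun φ hφ => hx φ (List.mem_of_mem_filter hφ)) (hx (neqAtom s t) (by simp [hΦ]))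
      refine ⟨⟨m, by omega⟩, ?_, fun h => hmk.ne (congrArg Fin.val h),
        (hneq ⟨m, by omega⟩ Φ₁ s t Φ₂ hΦ).2
          ⟨y, fun φ hφ hφn => hy φ (List.mem_filter.2 ⟨hφ, by simpa using hφn⟩), hs, ht⟩⟩
      rw [Fin.le_def]
      simp only [start, hl]
      exact hm
  · intro h
    -- Every query contains the positive part, so any position provides a solution of it; the empty
    -- instance has no position and is treated separately.
    have hbase : ∃ x : Var → A, ∀ φ ∈ Φ.filter (fun φ => isNeqAtom φ = false), φ.Holds x := by
      have : ∃ x : Var → A, ∀ φ ∈ Φ, isNeqAtom φ = false → φ.Holds x := by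
        cases hΦ : encodeInstance Φ with
        | nil =>
          have : Φ = [] := encodeInstance_injective hΦ
          exact ⟨fun _ => Classical.ofNonempty, by simp [this]⟩
        | cons l v =>
          obtain ⟨m, _, _, hm⟩ := h [] l v hΦ
          cases hl : isNeqLetter l with
          | false => exact (hpos m [] l v hΦ hl).1 hm
          | true =>
            obtain ⟨Φ₁, s, t, Φ₂, hΦ', hu, rfl, rfl⟩ :=
              exists_neqAtom_of_encodeInstance_eq Φ (u := []) hl hΦ
            obtain ⟨x, hx, _⟩ := (hneq m Φ₁ s t Φ₂ hΦ').1 (by rw [← hu]; exact hm)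
            exact ⟨x, hx⟩
      obtain ⟨x, hx⟩ := this
      exact ⟨x, fun φ hφ => hx φ (List.mem_of_mem_filter hφ) (by simpa using List.of_mem_filter hφ)⟩
    -- The queries at the disequalities were answered separately, possibly with different pairs; the
    -- embedding merges the resulting solutions.
    obtain ⟨x, hx₁, hx₂⟩ := exists_holds_of_forall_neqAtom e
      (Φ.filter fun φ => isNeqAtom φ = false) (Φ.filter fun φ => isNeqAtom φ = true) hbase (by
        intro θ hθ
        have hθn : isNeqAtom θ = true := by simpa using List.of_mem_filter hθ
        refine ⟨hθn, ?_⟩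
        obtain ⟨s, t, rfl⟩ := exists_eq_neqAtom hθn
        obtain ⟨Φ₁, Φ₂, hΦ⟩ := List.append_of_mem (List.mem_of_mem_filter hθ)
        obtain ⟨m, hm, hmk, hmY⟩ := h (encodeInstance Φ₁) (.rel (n := 2) (.inr NeqRel.neq))
          (neqTail s t ++ encodeInstance Φ₂) (by
            change encodeInstance Φ = _
            rw [hΦ]
            simp [encodeInstance, encodeAtom_neqAtom]
            rfl)
        obtain ⟨x, hx, hs, ht⟩ := (hneq m Φ₁ s t Φ₂ hΦ).1 hmY
        refine ⟨x, fun φ hφ => hx φ (List.mem_of_mem_filter hφ)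
          (by simpa using List.of_mem_filter hφ), ?_⟩
        rw [holds_neqAtom, hs, ht]
        refine hij m ?_ ?_
        · exact hm
        · exact lt_of_le_of_ne (Nat.le_of_lt_succ m.2) fun h => hmk (Fin.ext h))
    refine ⟨x, fun φ hφ => ?_⟩
    cases hφn : isNeqAtom φ with
    | false => exact hx₁ φ (List.mem_filter.2 ⟨hφ, by simpa using hφn⟩)
    | true => exact hx₂ φ (List.mem_filter.2 ⟨hφ, by simpa using hφn⟩)

end NeqToConstants

end CspEq

theorem mainTheorem12 (L : FirstOrder.Language) [Finite L.Symbols] (A : Type*) [Nonempty A]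
    [L.Structure A] (hmc : CspEq.ModelComplete L A) (hcat : CspEq.OmegaCategorical L A)
    (hsq : Nonempty (FirstOrder.Language.Embedding L (A × A) A)) :
    ∃ (n : ℕ) (a : Fin n → A),
      CspEq.PolyTimeEquivalent (CspEq.cspNeq L A) (CspEq.cspConstants L A a) := by
  obtain ⟨e⟩ := hsq
  obtain ⟨n, a, k, i, j, hk, hij, hpairs, Ψ₀, hΨ₀, hmax⟩ := CspEq.exists_constants hcat
  exact ⟨n, a, CspEq.polyTimeReducible_cspNeq_cspConstants e a i j hk hij hpairs,
    CspEq.polyTimeReducible_cspConstants_cspNeq a Ψ₀ hΨ₀ hmax⟩
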